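/- Let $\phi:\mathbf R^k\to\mathbf R$ be measurable, let $f$ be a probability density on $\mathbf R^k$, and let $I=\int\phi(x)f(x)\,dx$. Let $T:\mathbf R^k\to\mathbf R^p$ and $h:\mathbf R^k\to[0,\infty)$ be measurable, with $h$ not almost everywhere zero. For $\theta\in\mathbf R^p$ put $$A(\theta)=\log\int e^{\theta^TT(x)}h(x)\,dx\in\mathbf R\cup\{\infty\},\qquad f_\theta(x)=e^{\theta^TT(x)-A(\theta)}h(x),$$ with $f_\theta=0$ if $A(\theta)=\infty$, and $$V(\theta)=\int\frac{\phi^2f^2}{f_\theta}\,dx-I^2,\qquad K(\theta)=\int\frac{\phi^4f^4}{f_\theta^3}\,dx,$$ where $V(\theta)=K(\theta)=\infty$ if $A(\theta)=\infty$, and the conventions $0/0=0$, $a/0=\infty$ for $a>0$ are used inside these two integrals. Let $\Theta\subseteq\operatorname{int}\{\theta : K(\theta)<\infty\}$ be nonempty, convex and compact, and let $$V^\star=\inf_{\theta\in\Theta}V(\theta),\qquad D=\max_{\theta,\theta'\in\Theta}\|\theta-\theta'\|_2,\qquad G^2=\sup_{\theta\in\Theta}\mathbf E_{X\sim f_\theta}\left\|(\nabla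 A(\theta)-T(X))\frac{\phi^2(X)f^2(X)}{f_\theta^2(X)}\right\|_2^2 .$$ Then $\phi f$ is integrable, $A$ is differentiable at every point of $\Theta$, $V^\star$ is finite, and $G<\infty$. Moreover, let $C>0$ and $\theta_1\in\Theta$, and let $(\theta_i)_{i\ge1}$, $(X_i)_{i\ge1}$ be generated by the Convex AdaMC algorithm: for every $i\ge 1$, the conditional distribution of $X_i$ given $X_1,\dots,X_{i-1}$ has density $f_{\theta_i}$, and $$\theta_{i+1}=\Pi\left(\theta_i-\frac{C}{\sqrt i}\,g_i\right),\qquad g_i=(\nabla A(\theta_i)-T(X_i))\frac{\phi^2(X_i)f^2(X_i)}{f_{\theta_i}^2(X_i)},$$ where $\Pi$ is the Euclidean projection onto $\Theta$. Then for every $n\ge1$ the estimator $$\hat I_n=\frac1n\sum_{i=1}^n\frac{\phi(X_i)f(X_i)}{f_{\theta_i}(X_i)}$$ is square integrable, is unbiased, i.e. $\mathbf E\,\hat I_n=I$, and satisfies $$\frac{V^\star}{n}\le\mathrm{Var}(\hat I_n)\le\frac{V^\star}{n}+\left(\frac{D^2}{2C}+CG^2\right)\frac1{n^{3/2}} .$$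 -/

import Mathlib

open MeasureTheory ProbabilityTheory Set
open scoped ENNReal InnerProductSpace Gradient

noncomputable section

namespace ConvexAdaMC

/-- `ℝᵈ` with the Euclidean norm and Lebesgue measure. -/
abbrev Vec (d : ℕ) : Type := EuclideanSpace ℝ (Fin d)

variable {k p : ℕ}

/-! ### The exponential family with statistic `T` and base function `h` -/

/-- The normalizing integral `∫ exp(θᵀ T(x)) h(x) dx ∈ [0, ∞]`. -/
def partition (T : Vec k → Vec p) (h : Vec k → ℝ) (θ : Vec p) : ℝ≥0∞ :=
  ∫⁻ x, ENNReal.ofReal (Real.exp ⟪θ, T x⟫_ℝ * h x)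

/-- The log-partition function `A(θ) = log ∫ exp(θᵀ T(x)) h(x) dx`, which may be `∞`. -/
def logPartition (T : Vec k → Vec p) (h : Vec k → ℝ) (θ : Vec p) : EReal :=
  ENNReal.log (partition T h θ)

/-- The gradient `∇A(θ)`; it is only used where `A` is finite in a neighbourhood of `θ`. -/
def gradLogPartition (T : Vec k → Vec p) (h : Vec k → ℝ) (θ : Vec p) : Vec p :=
  gradient (fun t => (logPartition T h t).toReal) θ

open Classical in
/-- The density `f_θ(x) = exp(θᵀ T(x) - A(θ)) h(x)`, and `f_θ = 0` when `A(θ) = ∞`. -/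
def density (T : Vec k → Vec p) (h : Vec k → ℝ) (θ : Vec p) (x : Vec k) : ℝ :=
  if logPartition T h θ = ⊤ then 0
  else Real.exp (⟪θ, T x⟫_ℝ - (logPartition T h θ).toReal) * h x

/-- The sampling distribution `f_θ(x) dx`. -/
def sampling (T : Vec k → Vec p) (h : Vec k → ℝ) (θ : Vec p) : Measure (Vec k) :=
  volume.withDensity fun x => ENNReal.ofReal (density T h θ x)

/-! ### The importance sampling problem with integrand `φ` and nominal density `f` -/

/-- The target `I = ∫ φ(x) f(x) dx`. -/
def target (φ f : Vec k → ℝ) : ℝ := ∫ x, φ x * f x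

/-- The importance sampled value `φ(x) f(x) / f_θ(x)`. -/
def weighted (φ f : Vec k → ℝ) (T : Vec k → Vec p) (h : Vec k → ℝ)
    (θ : Vec p) (x : Vec k) : ℝ :=
  φ x * f x / density T h θ x

open Classical in
/-- The per-sample variance `V(θ) = ∫ φ²f²/f_θ dx - I²`, and `V(θ) = ∞` when `A(θ) = ∞`.
In `[0, ∞]` one has `0 / 0 = 0` and `a / 0 = ∞` for `a > 0`, so `V(θ) = ∞` also if `f_θ` vanishes
on a set of positive measure where `φ f` does not. -/
def V (φ f : Vec k → ℝ) (T : Vec k → Vec p) (h : Vec k → ℝ) (θ : Vec p) : EReal :=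
  if logPartition T h θ = ⊤ then ⊤
  else ((∫⁻ x, ENNReal.ofReal ((φ x * f x) ^ 2) / ENNReal.ofReal (density T h θ x) : ℝ≥0∞) : EReal)
    - ((target φ f ^ 2 : ℝ) : EReal)

/-- The optimal per-sample variance `V⋆ = inf_{θ ∈ Θ} V(θ)`. -/
def optimalV (φ f : Vec k → ℝ) (T : Vec k → Vec p) (h : Vec k → ℝ) (Θ : Set (Vec p)) : EReal :=
  ⨅ θ ∈ Θ, V φ f T h θ

open Classical in
/-- The fourth moment `K(θ) = ∫ φ⁴f⁴/f_θ³ dx` of the importance sampled value, and `K(θ) = ∞`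
when `A(θ) = ∞`. -/
def K (φ f : Vec k → ℝ) (T : Vec k → Vec p) (h : Vec k → ℝ) (θ : Vec p) : ℝ≥0∞ :=
  if logPartition T h θ = ⊤ then ⊤
  else ∫⁻ x, ENNReal.ofReal ((φ x * f x) ^ 4) / ENNReal.ofReal (density T h θ x) ^ 3

/-- The stochastic gradient `(∇A(θ) - T(x)) φ(x)² f(x)² / f_θ(x)²`. -/
def stochGrad (φ f : Vec k → ℝ) (T : Vec k → Vec p) (h : Vec k → ℝ)
    (θ : Vec p) (x : Vec k) : Vec p :=
  (weighted φ f T h θ x ^ 2) • (gradLogPartition T h θ - T x)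

/-- `G² = sup_{θ ∈ Θ} E_{X ∼ f_θ} ‖(∇A(θ) - T(X)) φ(X)² f(X)² / f_θ(X)²‖²`, as an element
of `[0, ∞]`. -/
def GSq (φ f : Vec k → ℝ) (T : Vec k → Vec p) (h : Vec k → ℝ) (Θ : Set (Vec p)) : ℝ≥0∞ :=
  ⨆ θ ∈ Θ, ∫⁻ x, ‖stochGrad φ f T h θ x‖ₑ ^ 2 ∂(sampling T h θ)

/-! ### The algorithm -/

/-- Euclidean projection onto `Θ`: the point of `Θ` nearest to `u` (which exists and is unique
when `Θ` is nonempty, convex and compact). -/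
def proj (Θ : Set (Vec p)) (u : Vec p) : Vec p :=
  Classical.epsilon fun v => v ∈ Θ ∧ ∀ w ∈ Θ, ‖u - v‖ ≤ ‖u - w‖

/-- The parameters as a function of the samples `x 0, x 1, …`. Indices start at `0` here:
`params … x i` is `θ_{i+1}` and `x i` is `X_{i+1}`, so that
`θ_{i+2} = Π(θ_{i+1} - (C / √(i+1)) g_{i+1})`. -/
def params (φ f : Vec k → ℝ) (T : Vec k → Vec p) (h : Vec k → ℝ) (Θ : Set (Vec p))
    (C : ℝ) (θ₁ : Vec p) (x : ℕ → Vec k) : ℕ → Vec p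
  | 0 => θ₁
  | i + 1 =>
    proj Θ (params φ f T h Θ C θ₁ x i
      - (C / √((i : ℝ) + 1)) • stochGrad φ f T h (params φ f T h Θ C θ₁ x i) (x i))

/-- The information in the samples before `X i`. -/
@[reducible] def past {Ω : Type*} (X : ℕ → Ω → Vec k) (i : ℕ) : MeasurableSpace Ω :=
  ⨆ j, ⨆ _ : j < i, MeasurableSpace.comap (X j) inferInstance

/-- `X 0, X 1, …` are samples produced by Convex AdaMC with step sizes `C / √n` and starting
point `θ₁`: the conditional distribution of each sample given all earlier ones is `f_θ(x) dx`,
where `θ` is the current parameter. -/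
structure IsRun {Ω : Type*} [MeasurableSpace Ω] (P : Measure Ω)
    (φ f : Vec k → ℝ) (T : Vec k → Vec p) (h : Vec k → ℝ) (Θ : Set (Vec p))
    (C : ℝ) (θ₁ : Vec p) (X : ℕ → Ω → Vec k) : Prop where
  measurable : ∀ i, Measurable (X i)
  cond_dist : ∀ i, ∀ B : Set (Vec k), MeasurableSet B →
    P⟦X i ⁻¹' B | past X i⟧ =ᵐ[P] fun ω =>
      (sampling T h (params φ f T h Θ C θ₁ (fun j => X j ω) i)).real B

/-- The Convex AdaMC estimator `Î_n = (1/n) ∑_{i=1}^n φ(X_i) f(X_i) / f_{θ_i}(X_i)`. -/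
def estimator {Ω : Type*} (φ f : Vec k → ℝ) (T : Vec k → Vec p) (h : Vec k → ℝ)
    (Θ : Set (Vec p)) (C : ℝ) (θ₁ : Vec p) (X : ℕ → Ω → Vec k) (n : ℕ) (ω : Ω) : ℝ :=
  (1 / (n : ℝ)) * ∑ i ∈ Finset.range n,
    weighted φ f T h (params φ f T h Θ C θ₁ (fun j => X j ω) i) (X i ω)

end ConvexAdaMC

end

/-! The second moment `V(θ) + I² = ∫ φ²f²/f_θ` equals `∫ (φ²f²/h) exp(A(θ) - θᵀT)`, which is convex
in `θ` because `A` is, and the mean of `stochGrad` under `f_θ` is a subgradient of it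
(`integral_weighted_sq_add_inner_le`). The algorithm is therefore projected stochastic gradient
descent on `V`.

Given the past, the `i`-th importance weight has mean `I` and variance `V(θ_i)`. The centred weights
are orthogonal, so `n² Var(Î_n) = ∑ E V(θ_i)` (`integral_sum_sub_target_sq`, `variance_estimator`).
Each term is at least `V⋆`, which is the lower bound. The excess over `n V⋆` is an expected regret:
convexity bounds it by `∑ E ⟪g_i, θ_i - θ'⟫`, and the pathwise bound `sum_inner_stochGrad_le` with
steps `C/√i` makes it at most `(D²/(2C) + C G²) √n`. Dividing by `n²` gives the rate `n^(-3/2)`.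

Integrability comes from `Θ` lying in an interior. Finiteness of `K` near `θ` makes the Laplace
transform of `T` under `h dx`, and of `-3T` under `φ⁴f⁴/h³ dx`, finite near `θ`; an exponential
moment then absorbs every power of `‖T‖`. This yields `∇A` and a locally uniform bound on `E‖g‖²`,
and compactness of `Θ` gives `G < ∞`.

Conditioning is done by disintegration: `map_history_prodMk` writes the joint law of the past and
the next sample as a composition product, so conditional expectations become inner integrals. -/

namespace ConvexAdaMC

open Filter Topology

variable {k p : ℕ}

/-! ### Laplace transforms finite near a point: moments and differentiation -/

section ExponentialMoments

/-- The norm is at most `p` times the largest `|t i|`, and the exponential of an absolute value is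
at most the sum over both signs. The summand `1` serves the case `p = 0`. -/
lemma exp_mul_norm_le (ε : ℝ) (hε : 0 ≤ ε) (t : Vec p) :
    Real.exp (ε * ‖t‖) ≤ 1 + ∑ i, (Real.exp (ε * p * t i) + Real.exp (-(ε * p * t i))) := by
  have hl1 : ‖t‖ ≤ ∑ i, |t i| := by
    conv_lhs => rw [← (EuclideanSpace.basisFun (Fin p) ℝ).sum_repr t]
    refine (norm_sum_le _ _).trans (Finset.sum_le_sum fun i _ => ?_)
    simp [norm_smul]
  have hnn : ∀ i, 0 ≤ Real.exp (ε * p * t i) + Real.exp (-(ε * p * t i)) := fun i => by positivity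
  rcases (Finset.univ : Finset (Fin p)).eq_empty_or_nonempty with he | hne
  · have : ‖t‖ = 0 := le_antisymm (by simpa [he] using hl1) (norm_nonneg _)
    simp [this, he]
  · obtain ⟨i, -, hi⟩ := Finset.exists_max_image Finset.univ (fun i => |t i|) hne
    have h1 : ‖t‖ ≤ p * |t i| := by
      refine hl1.trans ((Finset.sum_le_card_nsmul _ _ _ hi).trans ?_)
      simp
    have h2 : Real.exp (ε * ‖t‖) ≤ Real.exp (ε * p * t i) + Real.exp (-(ε * p * t i)) := by
      have h3 : ε * ‖t‖ ≤ ε * p * |t i| := by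
        rw [mul_assoc]; exact mul_le_mul_of_nonneg_left h1 hε
      rcases abs_cases (t i) with ⟨h, _⟩ | ⟨h, _⟩ <;> rw [h] at h3
      · linarith [Real.exp_le_exp.2 h3, Real.exp_pos (-(ε * p * t i))]
      · rw [mul_neg] at h3
        linarith [Real.exp_le_exp.2 h3, Real.exp_pos (ε * p * t i)]
    have h4 := Finset.single_le_sum (fun j _ => hnn j) (Finset.mem_univ i)
    linarith

variable {α : Type*} [MeasurableSpace α] {M : Measure α} {S : α → Vec p} {θ₀ : Vec p}

/-- If the Laplace transform is finite near `θ₀`, then an exponential moment of the norm is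
finite under the measure tilted by `θ₀`. -/
lemma exists_integrable_exp_inner_add_norm (hS : Measurable S)
    (hfin : ∀ᶠ θ in 𝓝 θ₀, ∫⁻ x, ENNReal.ofReal (Real.exp ⟪θ, S x⟫_ℝ) ∂M < ⊤) :
    ∃ ε > 0, Integrable (fun x => Real.exp (⟪θ₀, S x⟫_ℝ + ε * ‖S x‖)) M := by
  obtain ⟨r, hr, hball⟩ := Metric.eventually_nhds_iff.1 hfin
  have hp : (0 : ℝ) < p + 1 := by positivity
  -- Dividing by `p + 1` gives `ε * p < r`, also for `p = 0`, so the points `θ₀ ± ε p eᵢ` of the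
  -- dominating sum stay in the ball where the transform is finite.
  refine ⟨r / (p + 1), by positivity, ?_⟩
  set ε := r / (p + 1) with hε
  have hε0 : 0 < ε := by positivity
  have hint : ∀ θ, dist θ θ₀ < r → Integrable (fun x => Real.exp ⟪θ, S x⟫_ℝ) M := fun θ hθ =>
    ⟨by fun_prop, by
      rw [hasFiniteIntegral_iff_ofReal (ae_of_all _ fun x => (Real.exp_pos _).le)]
      exact hball hθ⟩
  have hεp : ε * p < r := by
    rw [hε, div_mul_eq_mul_div, div_lt_iff₀ hp]; nlinarith
  have hmem : ∀ i : Fin p, ∀ s : ℝ, |s| = 1 →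
      dist (θ₀ + (s * (ε * p)) • EuclideanSpace.single i (1 : ℝ)) θ₀ < r := fun i s hs => by
    rw [dist_eq_norm, add_sub_cancel_left, norm_smul]
    simpa [hs, abs_of_pos hε0] using hεp
  have hdom : Integrable (fun x => Real.exp ⟪θ₀, S x⟫_ℝ +
      ∑ i : Fin p, (Real.exp ⟪θ₀ + ((1 : ℝ) * (ε * p)) • EuclideanSpace.single i (1 : ℝ), S x⟫_ℝ +
        Real.exp ⟪θ₀ + ((-1 : ℝ) * (ε * p)) • EuclideanSpace.single i (1 : ℝ), S x⟫_ℝ)) M :=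
    (hint _ (by simpa using hr)).add (integrable_finsetSum _ fun i _ =>
      (hint _ (hmem i 1 (by simp))).add (hint _ (hmem i (-1) (by simp))))
  refine hdom.mono' (by fun_prop) (ae_of_all _ fun x => ?_)
  rw [Real.norm_of_nonneg (Real.exp_pos _).le, Real.exp_add]
  refine (mul_le_mul_of_nonneg_left (exp_mul_norm_le ε hε0.le (S x)) (Real.exp_pos _).le).trans
    (le_of_eq ?_)
  rw [mul_add, mul_one, Finset.mul_sum]
  congr 1
  refine Finset.sum_congr rfl fun i _ => ?_
  rw [mul_add, ← Real.exp_add, ← Real.exp_add]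
  simp [inner_add_left, inner_smul_left, EuclideanSpace.inner_single_left]

/-- Half of `ε` pays for moving from `θ₀` to `θ`; the other half absorbs the power through `xⁿ / n!
≤ eˣ`. The right side does not depend on `θ`, so it serves both as a dominating function and for
locally uniform moment bounds. -/
lemma norm_pow_mul_exp_inner_le (n : ℕ) {ε : ℝ} (hε : 0 < ε) {θ : Vec p}
    (hθ : ‖θ - θ₀‖ ≤ ε / 2) (t : Vec p) :
    ‖t‖ ^ n * Real.exp ⟪θ, t⟫_ℝ ≤
      (n.factorial * (2 / ε) ^ n) * Real.exp (⟪θ₀, t⟫_ℝ + ε * ‖t‖) := by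
  have h1 : ⟪θ, t⟫_ℝ ≤ ⟪θ₀, t⟫_ℝ + ε / 2 * ‖t‖ := by
    have := (real_inner_le_norm (θ - θ₀) t).trans
      (mul_le_mul_of_nonneg_right hθ (norm_nonneg t))
    rw [inner_sub_left] at this
    linarith
  have h2 : ‖t‖ ^ n ≤ (n.factorial * (2 / ε) ^ n) * Real.exp (ε / 2 * ‖t‖) := by
    have := Real.pow_div_factorial_le_exp (ε / 2 * ‖t‖) (by positivity) n
    rw [div_le_iff₀ (by positivity), mul_pow] at this
    calc ‖t‖ ^ n = (2 / ε) ^ n * ((ε / 2) ^ n * ‖t‖ ^ n) := by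
          rw [← mul_assoc, ← mul_pow, show 2 / ε * (ε / 2) = 1 by field_simp, one_pow, one_mul]
      _ ≤ (2 / ε) ^ n * (Real.exp (ε / 2 * ‖t‖) * n.factorial) := by gcongr
      _ = _ := by ring
  calc ‖t‖ ^ n * Real.exp ⟪θ, t⟫_ℝ
      ≤ ((n.factorial * (2 / ε) ^ n) * Real.exp (ε / 2 * ‖t‖)) *
          Real.exp (⟪θ₀, t⟫_ℝ + ε / 2 * ‖t‖) := by gcongr
    _ = _ := by rw [mul_assoc, ← Real.exp_add]; ring_nf

lemma integrable_norm_pow_mul_exp_inner (hS : Measurable S) {ε : ℝ} (hε : 0 < ε)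
    (hint : Integrable (fun x => Real.exp (⟪θ₀, S x⟫_ℝ + ε * ‖S x‖)) M) {θ : Vec p}
    (hθ : ‖θ - θ₀‖ ≤ ε / 2) (n : ℕ) :
    Integrable (fun x => ‖S x‖ ^ n * Real.exp ⟪θ, S x⟫_ℝ) M := by
  refine (hint.const_mul (n.factorial * (2 / ε) ^ n)).mono' (by fun_prop) (ae_of_all _ fun x => ?_)
  rw [Real.norm_of_nonneg (by positivity)]
  exact norm_pow_mul_exp_inner_le n hε hθ _

lemma integral_norm_pow_mul_exp_inner_le (hS : Measurable S) {ε : ℝ} (hε : 0 < ε)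
    (hint : Integrable (fun x => Real.exp (⟪θ₀, S x⟫_ℝ + ε * ‖S x‖)) M) {θ : Vec p}
    (hθ : ‖θ - θ₀‖ ≤ ε / 2) (n : ℕ) :
    ∫ x, ‖S x‖ ^ n * Real.exp ⟪θ, S x⟫_ℝ ∂M ≤
      (n.factorial * (2 / ε) ^ n) * ∫ x, Real.exp (⟪θ₀, S x⟫_ℝ + ε * ‖S x‖) ∂M := by
  rw [← integral_const_mul]
  exact integral_mono (integrable_norm_pow_mul_exp_inner hS hε hint hθ n) (hint.const_mul _)
    fun x => norm_pow_mul_exp_inner_le n hε hθ _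

lemma hasGradientAt_integral_exp_inner (hS : Measurable S) {ε : ℝ} (hε : 0 < ε)
    (hint : Integrable (fun x => Real.exp (⟪θ₀, S x⟫_ℝ + ε * ‖S x‖)) M) :
    HasGradientAt (fun θ => ∫ x, Real.exp ⟪θ, S x⟫_ℝ ∂M)
      (∫ x, Real.exp ⟪θ₀, S x⟫_ℝ • S x ∂M) θ₀ := by
  have hθ₀ : ‖θ₀ - θ₀‖ ≤ ε / 2 := by simp; positivity
  have key := hasFDerivAt_integral_of_dominated_of_fderiv_le (μ := M) (𝕜 := ℝ)
    (F := fun θ x => Real.exp ⟪θ, S x⟫_ℝ)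
    (F' := fun θ x => Real.exp ⟪θ, S x⟫_ℝ • innerSL ℝ (S x)) (x₀ := θ₀)
    (s := Metric.ball θ₀ (ε / 2))
    (bound := fun x => ((1 : ℕ).factorial * (2 / ε) ^ 1) * Real.exp (⟪θ₀, S x⟫_ℝ + ε * ‖S x‖))
    (Metric.ball_mem_nhds _ (by positivity)) (Eventually.of_forall fun θ => by fun_prop)
    (by simpa using integrable_norm_pow_mul_exp_inner hS hε hint hθ₀ 0) (by fun_prop)
    (ae_of_all _ fun x θ hθ => ?_) (hint.const_mul _) (ae_of_all _ fun x θ _ => ?_)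
  · have hi : Integrable (fun x => Real.exp ⟪θ₀, S x⟫_ℝ • S x) M := by
      refine (integrable_norm_pow_mul_exp_inner hS hε hint hθ₀ 1).mono' (by fun_prop)
        (ae_of_all _ fun x => ?_)
      rw [norm_smul, Real.norm_of_nonneg (Real.exp_pos _).le, pow_one, mul_comm]
    have hdual : InnerProductSpace.toDual ℝ (Vec p) (∫ x, Real.exp ⟪θ₀, S x⟫_ℝ • S x ∂M) =
        ∫ x, Real.exp ⟪θ₀, S x⟫_ℝ • innerSL ℝ (S x) ∂M := by
      refine ((innerSL ℝ (E := Vec p)).integral_comp_comm hi).symm.trans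
        (integral_congr_ae (ae_of_all _ fun x => ?_))
      simp
    rw [hasGradientAt_iff_hasFDerivAt, hdual]
    exact key
  · rw [norm_smul, innerSL_apply_norm, Real.norm_of_nonneg (Real.exp_pos _).le, mul_comm]
    have := norm_pow_mul_exp_inner_le 1 hε (mem_ball_iff_norm.1 hθ).le (S x)
    simpa using this
  · have h1 : HasFDerivAt (fun θ : Vec p => ⟪θ, S x⟫_ℝ) (innerSL ℝ (S x)) θ := by
      have := (innerSL ℝ (S x)).hasFDerivAt (x := θ)
      refine this.congr_of_eventuallyEq (Eventually.of_forall fun θ => ?_)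
      simp [real_inner_comm]
    exact h1.exp

end ExponentialMoments

/-! ### The log-partition function: gradient, convexity, local bounds -/

section ExponentialFamily

variable {T : Vec k → Vec p} {h : Vec k → ℝ} {θ θ' θ₀ : Vec p}

/-- The measure `h(x) dx`. -/
noncomputable def baseMeasure (h : Vec k → ℝ) : Measure (Vec k) :=
  volume.withDensity fun x => ENNReal.ofReal (h x)

lemma partition_eq_lintegral_baseMeasure (hT : Measurable T) (hh : Measurable h) (θ : Vec p) :
    partition T h θ = ∫⁻ x, ENNReal.ofReal (Real.exp ⟪θ, T x⟫_ℝ) ∂(baseMeasure h) := by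
  rw [partition, baseMeasure, lintegral_withDensity_eq_lintegral_mul _ (by fun_prop) (by fun_prop)]
  refine lintegral_congr fun x => ?_
  rw [Pi.mul_apply, ENNReal.ofReal_mul (Real.exp_pos _).le, mul_comm]

lemma toReal_partition (hT : Measurable T) (hh : Measurable h) (θ : Vec p) :
    (partition T h θ).toReal = ∫ x, Real.exp ⟪θ, T x⟫_ℝ ∂(baseMeasure h) := by
  rw [partition_eq_lintegral_baseMeasure hT hh, integral_eq_lintegral_of_nonneg_ae
    (ae_of_all _ fun x => (Real.exp_pos _).le) (by fun_prop)]

lemma partition_ne_zero (hT : Measurable T) (hh : Measurable h) (hh_nonneg : ∀ x, 0 ≤ h x)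
    (hh_ne : ¬ ∀ᵐ x, h x = 0) (θ : Vec p) : partition T h θ ≠ 0 := by
  intro h0
  rw [partition, lintegral_eq_zero_iff (by fun_prop)] at h0
  refine hh_ne (h0.mono fun x hx => ?_)
  have h1 : Real.exp ⟪θ, T x⟫_ℝ * h x ≤ 0 := ENNReal.ofReal_eq_zero.1 hx
  exact le_antisymm (nonpos_of_mul_nonpos_right h1 (Real.exp_pos _)) (hh_nonneg x)

lemma logPartition_eq_top_iff : logPartition T h θ = ⊤ ↔ partition T h θ = ⊤ := by
  simp [logPartition]

/-- No finiteness is needed, since both sides default to `0` when the partition function is `0` or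
`⊤`. Hence this rewrites whole functions under a derivative. -/
lemma toReal_logPartition (θ : Vec p) :
    (logPartition T h θ).toReal = Real.log (partition T h θ).toReal := by
  rw [logPartition]
  by_cases h0 : partition T h θ = 0
  · simp [h0]
  by_cases h1 : partition T h θ = ⊤
  · simp [h1]
  · rw [ENNReal.log_pos_real h0 h1, EReal.toReal_coe]

lemma exp_toReal_logPartition (h0 : partition T h θ ≠ 0) (h1 : partition T h θ ≠ ⊤) :
    Real.exp (logPartition T h θ).toReal = (partition T h θ).toReal := by
  rw [toReal_logPartition, Real.exp_log (ENNReal.toReal_pos h0 h1)]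

lemma density_of_ne_top (h1 : partition T h θ ≠ ⊤) (x : Vec k) :
    density T h θ x = Real.exp (⟪θ, T x⟫_ℝ - (logPartition T h θ).toReal) * h x := by
  rw [density, if_neg (by rwa [logPartition_eq_top_iff])]

lemma density_nonneg (hh_nonneg : ∀ x, 0 ≤ h x) (θ : Vec p) (x : Vec k) :
    0 ≤ density T h θ x := by
  unfold density
  split_ifs
  · exact le_rfl
  · exact mul_nonneg (Real.exp_pos _).le (hh_nonneg x)

lemma integrable_exp_inner (hT : Measurable T) (hh : Measurable h) (h1 : partition T h θ ≠ ⊤) :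
    Integrable (fun x => Real.exp ⟪θ, T x⟫_ℝ) (baseMeasure h) :=
  ⟨by fun_prop, by
    rw [hasFiniteIntegral_iff_ofReal (ae_of_all _ fun x => (Real.exp_pos _).le),
      ← partition_eq_lintegral_baseMeasure hT hh]
    exact h1.lt_top⟩

lemma sampling_eq_tilted (hT : Measurable T) (hh : Measurable h)
    (h0 : partition T h θ ≠ 0) (h1 : partition T h θ ≠ ⊤) :
    sampling T h θ = (baseMeasure h).tilted fun x => ⟪θ, T x⟫_ℝ := by
  rw [sampling, Measure.tilted, ← toReal_partition hT hh, baseMeasure,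
    ← withDensity_mul _ (by fun_prop) (by fun_prop)]
  congr 1
  ext x
  rw [Pi.mul_apply, density_of_ne_top h1, Real.exp_sub, exp_toReal_logPartition h0 h1,
    ENNReal.ofReal_mul (by positivity), mul_comm]

lemma isProbabilityMeasure_sampling (hT : Measurable T) (hh : Measurable h)
    (h0 : partition T h θ ≠ 0) (h1 : partition T h θ ≠ ⊤) :
    IsProbabilityMeasure (sampling T h θ) := by
  rw [sampling_eq_tilted hT hh h0 h1]
  have : NeZero (baseMeasure h) := ⟨fun hb => h0 (by
    rw [partition_eq_lintegral_baseMeasure hT hh, hb, lintegral_zero_measure])⟩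
  exact isProbabilityMeasure_tilted (integrable_exp_inner hT hh h1)

lemma exists_integrable_exp_inner_add_norm_baseMeasure (hT : Measurable T) (hh : Measurable h)
    (hfin : ∀ᶠ θ in 𝓝 θ₀, partition T h θ ≠ ⊤) :
    ∃ ε > 0, Integrable (fun x => Real.exp (⟪θ₀, T x⟫_ℝ + ε * ‖T x‖)) (baseMeasure h) :=
  exists_integrable_exp_inner_add_norm hT (hfin.mono fun θ hθ => by
    rw [← partition_eq_lintegral_baseMeasure hT hh]; exact hθ.lt_top)

lemma integrable_sampling (hT : Measurable T) (hh : Measurable h)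
    (h0 : partition T h θ ≠ 0) (hfin : ∀ᶠ t in 𝓝 θ, partition T h t ≠ ⊤) :
    Integrable T (sampling T h θ) := by
  obtain ⟨ε, hε, hint⟩ := exists_integrable_exp_inner_add_norm_baseMeasure hT hh hfin
  have h1 := hfin.self_of_nhds
  rw [sampling_eq_tilted hT hh h0 h1, integrable_tilted_iff (integrable_exp_inner hT hh h1)]
  refine (integrable_norm_pow_mul_exp_inner (θ := θ) hT hε hint (by simpa using (half_pos hε).le) 1).mono'
    (by fun_prop) (ae_of_all _ fun x => ?_)
  rw [norm_smul, Real.norm_of_nonneg (Real.exp_pos _).le, pow_one, mul_comm]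

/-- The logarithmic derivative `∇Z / Z` is the mean of `T` under the tilted measure. -/
lemma hasGradientAt_logPartition (hT : Measurable T) (hh : Measurable h)
    (h0 : partition T h θ ≠ 0) (hfin : ∀ᶠ t in 𝓝 θ, partition T h t ≠ ⊤) :
    HasGradientAt (fun t => (logPartition T h t).toReal) (∫ x, T x ∂(sampling T h θ)) θ := by
  obtain ⟨ε, hε, hint⟩ := exists_integrable_exp_inner_add_norm_baseMeasure hT hh hfin
  have h1 := hfin.self_of_nhds
  have hZ := hasGradientAt_integral_exp_inner hT hε hint
  simp only [← toReal_partition hT hh] at hZ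
  have hlog := (hasGradientAt_iff_hasFDerivAt.1 hZ).log (ENNReal.toReal_pos h0 h1).ne'
  simp only [← toReal_logPartition] at hlog
  have hval : ∫ x, T x ∂(sampling T h θ) =
      (partition T h θ).toReal⁻¹ • ∫ x, Real.exp ⟪θ, T x⟫_ℝ • T x ∂(baseMeasure h) := by
    rw [sampling_eq_tilted hT hh h0 h1, integral_tilted, ← toReal_partition hT hh,
      ← integral_smul]
    simp only [smul_smul, div_eq_inv_mul]
  rw [hasGradientAt_iff_hasFDerivAt, hval]
  convert! hlog using 1
  ext y
  simp

lemma gradLogPartition_eq (hT : Measurable T) (hh : Measurable h)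
    (h0 : partition T h θ ≠ 0) (hfin : ∀ᶠ t in 𝓝 θ, partition T h t ≠ ⊤) :
    gradLogPartition T h θ = ∫ x, T x ∂(sampling T h θ) :=
  (hasGradientAt_logPartition hT hh h0 hfin).gradient

/-- The gradient inequality for the convex function `A`. -/
lemma inner_gradLogPartition_le (hT : Measurable T) (hh : Measurable h)
    (h0 : partition T h θ ≠ 0) (hfin : ∀ᶠ t in 𝓝 θ, partition T h t ≠ ⊤)
    (h0' : partition T h θ' ≠ 0) (h1' : partition T h θ' ≠ ⊤) :
    ⟪gradLogPartition T h θ, θ' - θ⟫_ℝ ≤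
      (logPartition T h θ').toReal - (logPartition T h θ).toReal := by
  have h1 := hfin.self_of_nhds
  have := isProbabilityMeasure_sampling hT hh h0 h1
  have hTi := integrable_sampling hT hh h0 hfin
  have hexp : (fun x => Real.exp ⟪θ, T x⟫_ℝ • Real.exp ⟪θ' - θ, T x⟫_ℝ) =
      fun x => Real.exp ⟪θ', T x⟫_ℝ := by
    ext x
    rw [smul_eq_mul, ← Real.exp_add, inner_sub_left]
    ring_nf
  have hei : Integrable (fun x => Real.exp ⟪θ' - θ, T x⟫_ℝ) (sampling T h θ) := by
    rw [sampling_eq_tilted hT hh h0 h1, integrable_tilted_iff (integrable_exp_inner hT hh h1), hexp]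
    exact integrable_exp_inner hT hh h1'
  have hii : Integrable (fun x => ⟪θ' - θ, T x⟫_ℝ) (sampling T h θ) := hTi.const_inner _
  -- Jensen: the exponential of the mean of `⟪θ' - θ, T⟫` is at most the mean of the exponential,
  -- which is `Z(θ') / Z(θ)`. Taking logarithms gives the claim.
  have hJ := convexOn_exp.map_integral_le Real.continuous_exp.continuousOn isClosed_univ
    (ae_of_all _ fun x => mem_univ _) hii hei
  have hval : ∫ x, Real.exp ⟪θ' - θ, T x⟫_ℝ ∂(sampling T h θ) =
      Real.exp ((logPartition T h θ').toReal - (logPartition T h θ).toReal) := by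
    rw [sampling_eq_tilted hT hh h0 h1, integral_tilted, Real.exp_sub,
      exp_toReal_logPartition h0 h1, exp_toReal_logPartition h0' h1', toReal_partition hT hh θ',
      toReal_partition hT hh θ, ← hexp, ← integral_div]
    simp only [smul_eq_mul, div_mul_eq_mul_div]
  rw [hval] at hJ
  rw [gradLogPartition_eq hT hh h0 hfin, real_inner_comm, ← integral_inner hTi]
  exact Real.exp_le_exp.1 hJ

lemma eventually_norm_gradLogPartition_le (hT : Measurable T) (hh : Measurable h)
    (h0 : ∀ θ, partition T h θ ≠ 0) (hfin : ∀ᶠ t in 𝓝 θ₀, partition T h t ≠ ⊤) :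
    ∃ R, ∀ᶠ θ in 𝓝 θ₀, Real.exp (logPartition T h θ).toReal ≤ R ∧ ‖gradLogPartition T h θ‖ ≤ R := by
  obtain ⟨ε, hε, hint⟩ := exists_integrable_exp_inner_add_norm_baseMeasure hT hh hfin
  set c : ℕ → ℝ := fun n => n.factorial * (2 / ε) ^ n *
    ∫ x, Real.exp (⟪θ₀, T x⟫_ℝ + ε * ‖T x‖) ∂(baseMeasure h) with hc
  have hZ := (hasGradientAt_integral_exp_inner hT hε hint).continuousAt
  simp only [← toReal_partition hT hh] at hZ
  have hpos := ENNReal.toReal_pos (h0 θ₀) hfin.self_of_nhds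
  have hev := hZ.eventually (eventually_gt_nhds (half_lt_self hpos))
  -- `c 0` and `c 1` bound `Z(θ)` and the unnormalized first moment near `θ₀`; by continuity `Z`
  -- stays above half its value at `θ₀`.
  refine ⟨max (c 0) (c 1 / ((partition T h θ₀).toReal / 2)), ?_⟩
  filter_upwards [hev, eventually_eventually_nhds.2 hfin, Metric.ball_mem_nhds θ₀ (half_pos hε)]
    with θ hθ hfinθ hball
  have hd : ‖θ - θ₀‖ ≤ ε / 2 := (mem_ball_iff_norm.1 hball).le
  have h1 := hfinθ.self_of_nhds
  constructor
  · refine le_max_of_le_left ?_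
    rw [exp_toReal_logPartition (h0 θ) h1, toReal_partition hT hh]
    simpa [hc] using integral_norm_pow_mul_exp_inner_le hT hε hint hd 0
  · refine le_max_of_le_right ?_
    rw [gradLogPartition_eq hT hh (h0 θ) hfinθ, sampling_eq_tilted hT hh (h0 θ) h1, integral_tilted]
    calc _ ≤ ∫ x, ‖(Real.exp ⟪θ, T x⟫_ℝ / ∫ x, Real.exp ⟪θ, T x⟫_ℝ ∂(baseMeasure h)) • T x‖
          ∂(baseMeasure h) := norm_integral_le_integral_norm _
      _ = (∫ x, ‖T x‖ ^ 1 * Real.exp ⟪θ, T x⟫_ℝ ∂(baseMeasure h)) / (partition T h θ).toReal := by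
        rw [← integral_div, toReal_partition hT hh]
        refine integral_congr_ae (ae_of_all _ fun x => ?_)
        have : 0 ≤ ∫ x, Real.exp ⟪θ, T x⟫_ℝ ∂(baseMeasure h) :=
          integral_nonneg fun x => (Real.exp_pos _).le
        simp only [norm_smul, norm_div, Real.norm_of_nonneg (Real.exp_pos _).le,
          Real.norm_of_nonneg this, pow_one]
        ring
      _ ≤ c 1 / ((partition T h θ₀).toReal / 2) := by
        refine div_le_div₀ ?_ (integral_norm_pow_mul_exp_inner_le hT hε hint hd 1) (by positivity)
          hθ.le
        have : 0 ≤ ∫ x, Real.exp (⟪θ₀, T x⟫_ℝ + ε * ‖T x‖) ∂(baseMeasure h) :=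
          integral_nonneg fun x => (Real.exp_pos _).le
        positivity

end ExponentialFamily

/-! ### Joint measurability in the parameter and the sample point -/

section Measurability

variable {φ f : Vec k → ℝ} {T : Vec k → Vec p} {h : Vec k → ℝ}

lemma measurable_partition (hT : Measurable T) (hh : Measurable h) : Measurable (partition T h) := by
  unfold partition
  exact Measurable.lintegral_prod_right' (f := fun q : Vec p × Vec k =>
    ENNReal.ofReal (Real.exp ⟪q.1, T q.2⟫_ℝ * h q.2)) (by fun_prop)

lemma measurable_logPartition (hT : Measurable T) (hh : Measurable h) :
    Measurable (logPartition T h) :=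
  ENNReal.continuous_log.measurable.comp (measurable_partition hT hh)

lemma measurable_density (hT : Measurable T) (hh : Measurable h) :
    Measurable fun q : Vec p × Vec k => density T h q.1 q.2 := by
  have hA := measurable_logPartition hT hh
  unfold density
  exact Measurable.ite (measurableSet_eq_fun (hA.comp measurable_fst) measurable_const)
    measurable_const (by fun_prop)

lemma measurable_density_right (hT : Measurable T) (hh : Measurable h) (θ : Vec p) :
    Measurable fun x => density T h θ x :=
  Measurable.of_uncurry_left (f := density T h) (measurable_density hT hh)

/-- The derivative of an arbitrary function is measurable, so points where `A` is not differentiable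
need no separate treatment. -/
lemma measurable_gradLogPartition (T : Vec k → Vec p) (h : Vec k → ℝ) :
    Measurable (gradLogPartition T h) := by
  unfold gradLogPartition gradient
  exact (InnerProductSpace.toDual ℝ (Vec p)).symm.continuous.measurable.comp (measurable_fderiv ℝ _)

lemma measurable_weighted (hφ : Measurable φ) (hf : Measurable f) (hT : Measurable T)
    (hh : Measurable h) : Measurable fun q : Vec p × Vec k => weighted φ f T h q.1 q.2 := by
  have := measurable_density hT hh
  unfold weighted
  fun_prop

lemma measurable_weighted_right (hφ : Measurable φ) (hf : Measurable f) (hT : Measurable T)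
    (hh : Measurable h) (θ : Vec p) : Measurable fun x => weighted φ f T h θ x :=
  (measurable_weighted hφ hf hT hh).comp measurable_prodMk_left

lemma measurable_stochGrad (hφ : Measurable φ) (hf : Measurable f) (hT : Measurable T)
    (hh : Measurable h) : Measurable fun q : Vec p × Vec k => stochGrad φ f T h q.1 q.2 := by
  have := measurable_weighted hφ hf hT hh
  have := measurable_gradLogPartition T h
  unfold stochGrad
  fun_prop

lemma measurable_stochGrad_right (hφ : Measurable φ) (hf : Measurable f) (hT : Measurable T)
    (hh : Measurable h) (θ : Vec p) : Measurable fun x => stochGrad φ f T h θ x :=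
  (measurable_stochGrad hφ hf hT hh).comp measurable_prodMk_left

lemma lintegral_sampling (hT : Measurable T) (hh : Measurable h) (θ : Vec p) {F : Vec k → ℝ≥0∞}
    (hF : Measurable F) :
    ∫⁻ x, F x ∂(sampling T h θ) = ∫⁻ x, ENNReal.ofReal (density T h θ x) * F x :=
  lintegral_withDensity_eq_lintegral_mul _
    (measurable_density_right hT hh θ).ennreal_ofReal hF

lemma integral_sampling (hT : Measurable T) (hh : Measurable h) (hh_nonneg : ∀ x, 0 ≤ h x)
    (θ : Vec p) (F : Vec k → ℝ) :
    ∫ x, F x ∂(sampling T h θ) = ∫ x, density T h θ x * F x := by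
  rw [sampling, integral_withDensity_eq_integral_toReal_smul
    (measurable_density_right hT hh θ).ennreal_ofReal
    (ae_of_all _ fun x => ENNReal.ofReal_lt_top)]
  simp [ENNReal.toReal_ofReal (density_nonneg hh_nonneg θ _)]

lemma integrable_sampling_iff (hT : Measurable T) (hh : Measurable h) (hh_nonneg : ∀ x, 0 ≤ h x)
    (θ : Vec p) (F : Vec k → ℝ) :
    Integrable F (sampling T h θ) ↔ Integrable fun x => density T h θ x * F x := by
  rw [sampling, integrable_withDensity_iff_integrable_smul'
    (measurable_density_right hT hh θ).ennreal_ofReal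
    (ae_of_all _ fun x => ENNReal.ofReal_lt_top)]
  simp [ENNReal.toReal_ofReal (density_nonneg hh_nonneg θ _)]

end Measurability

/-! ### Moments of the importance weights and of the stochastic gradient -/

section ImportanceSampling

variable {φ f : Vec k → ℝ} {T : Vec k → Vec p} {h : Vec k → ℝ} {θ θ' θ₀ : Vec p}

lemma partition_ne_top_of_K_lt_top (hK : K φ f T h θ < ⊤) : partition T h θ ≠ ⊤ := by
  intro h1
  rw [K, if_pos (logPartition_eq_top_iff.2 h1)] at hK
  exact lt_irrefl _ hK

lemma K_of_ne_top (h1 : partition T h θ ≠ ⊤) : K φ f T h θ =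
    ∫⁻ x, ENNReal.ofReal ((φ x * f x) ^ 4) / ENNReal.ofReal (density T h θ x) ^ 3 := by
  rw [K, if_neg (by rwa [logPartition_eq_top_iff])]

/-- The measure `φ⁴ f⁴ / h³ dx`. -/
noncomputable def fourthMeasure (φ f : Vec k → ℝ) (h : Vec k → ℝ) : Measure (Vec k) :=
  volume.withDensity fun x => ENNReal.ofReal ((φ x * f x) ^ 4) / ENNReal.ofReal (h x) ^ 3

/-- Up to the factor `exp(3A)`, `K` is a Laplace transform of `-3T`, so its finiteness near a point
yields exponential moments under `fourthMeasure`. -/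
lemma K_eq_lintegral_fourthMeasure (hφ : Measurable φ) (hf : Measurable f) (hT : Measurable T)
    (hh : Measurable h) (h1 : partition T h θ ≠ ⊤) :
    K φ f T h θ = ENNReal.ofReal (Real.exp (3 * (logPartition T h θ).toReal)) *
      ∫⁻ x, ENNReal.ofReal (Real.exp ⟪θ, (-3 : ℝ) • T x⟫_ℝ) ∂(fourthMeasure φ f h) := by
  rw [K_of_ne_top h1, fourthMeasure, lintegral_withDensity_eq_lintegral_mul _ (by fun_prop)
    (by fun_prop), ← lintegral_const_mul _ (by fun_prop)]
  refine lintegral_congr fun x => ?_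
  rw [Pi.mul_apply, density_of_ne_top h1, ENNReal.ofReal_mul (Real.exp_pos _).le,
    mul_pow (ENNReal.ofReal (Real.exp _)), ENNReal.div_eq_inv_mul, ENNReal.mul_inv (Or.inl (by positivity)) (Or.inl (by finiteness)),
    ← ENNReal.ofReal_pow (Real.exp_pos _).le, ← ENNReal.ofReal_inv_of_pos (by positivity),
    ← Real.exp_nat_mul, ← Real.exp_neg, mul_left_comm, ← ENNReal.ofReal_mul (Real.exp_pos _).le,
    ← Real.exp_add, inner_smul_right, ENNReal.div_eq_inv_mul,
    show -((3 : ℕ) * (⟪θ, T x⟫_ℝ - (logPartition T h θ).toReal)) =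
      3 * (logPartition T h θ).toReal + -3 * ⟪θ, T x⟫_ℝ by push_cast; ring]
  ring

lemma lintegral_fourthMeasure_lt_top (hφ : Measurable φ) (hf : Measurable f) (hT : Measurable T)
    (hh : Measurable h) (hK : K φ f T h θ < ⊤) :
    ∫⁻ x, ENNReal.ofReal (Real.exp ⟪θ, (-3 : ℝ) • T x⟫_ℝ) ∂(fourthMeasure φ f h) < ⊤ := by
  rw [K_eq_lintegral_fourthMeasure hφ hf hT hh (partition_ne_top_of_K_lt_top hK)] at hK
  exact ENNReal.lt_top_of_mul_ne_top_right hK.ne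
    (ENNReal.ofReal_pos.2 (Real.exp_pos _)).ne'

/-- Where the density vanishes and `φ f` does not, the integrand of `K` is `∞`. This is the absolute
continuity behind unbiasedness: `weighted` uses real division and silently returns `0` at such
points. -/
lemma ae_eq_zero_of_density_eq_zero (hφ : Measurable φ) (hf : Measurable f) (hT : Measurable T)
    (hh : Measurable h) (hK : K φ f T h θ < ⊤) :
    ∀ᵐ x, density T h θ x = 0 → φ x * f x = 0 := by
  have hd := measurable_density_right hT hh θ
  rw [K_of_ne_top (partition_ne_top_of_K_lt_top hK)] at hK
  filter_upwards [ae_lt_top (by fun_prop) hK.ne] with x hx h0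
  by_contra hne
  have hpos : (0 : ℝ) < (φ x * f x) ^ 4 := by positivity
  rw [h0, ENNReal.ofReal_zero, zero_pow (by norm_num),
    ENNReal.div_zero (ENNReal.ofReal_pos.2 hpos).ne'] at hx
  exact lt_irrefl _ hx

lemma density_mul_weighted_ae (hφ : Measurable φ) (hf : Measurable f) (hT : Measurable T)
    (hh : Measurable h) (hK : K φ f T h θ < ⊤) :
    (fun x => density T h θ x * weighted φ f T h θ x) =ᵐ[volume] fun x => φ x * f x := by
  filter_upwards [ae_eq_zero_of_density_eq_zero hφ hf hT hh hK] with x hx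
  by_cases h0 : density T h θ x = 0
  · rw [h0, zero_mul, hx h0]
  · rw [weighted]; field_simp

lemma memLp_four_weighted (hφ : Measurable φ) (hf : Measurable f) (hT : Measurable T)
    (hh : Measurable h) (hh_nonneg : ∀ x, 0 ≤ h x) (hK : K φ f T h θ < ⊤) :
    MemLp (weighted φ f T h θ) 4 (sampling T h θ) := by
  have hw := measurable_weighted_right hφ hf hT hh θ
  refine ⟨hw.aestronglyMeasurable, ?_⟩
  rw [eLpNorm_lt_top_iff_lintegral_rpow_enorm_lt_top (by norm_num) (by norm_num)]
  refine lt_of_le_of_lt ?_ hK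
  rw [K_of_ne_top (partition_ne_top_of_K_lt_top hK), lintegral_sampling hT hh θ (by fun_prop)]
  refine lintegral_mono fun x => ?_
  by_cases h0 : density T h θ x = 0
  · simp [h0]
  · have hpos : 0 < density T h θ x := (density_nonneg hh_nonneg θ x).lt_of_ne' h0
    refine le_of_eq ?_
    rw [← ofReal_norm, ← ENNReal.ofReal_pow hpos.le,
      ← ENNReal.ofReal_div_of_pos (by positivity)]
    have : (4 : ℝ≥0∞).toReal = (4 : ℕ) := by norm_num
    rw [this, ENNReal.rpow_natCast, ← ENNReal.ofReal_pow (norm_nonneg _),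
      ← ENNReal.ofReal_mul hpos.le, Real.norm_eq_abs, show (4 : ℕ) = 2 * 2 from rfl, pow_mul,
      sq_abs, weighted]
    congr 1
    field_simp
    ring

lemma memLp_two_weighted (hφ : Measurable φ) (hf : Measurable f) (hT : Measurable T)
    (hh : Measurable h) (hh_nonneg : ∀ x, 0 ≤ h x) (h0 : partition T h θ ≠ 0)
    (hK : K φ f T h θ < ⊤) : MemLp (weighted φ f T h θ) 2 (sampling T h θ) := by
  have := isProbabilityMeasure_sampling hT hh h0 (partition_ne_top_of_K_lt_top hK)
  exact (memLp_four_weighted hφ hf hT hh hh_nonneg hK).mono_exponent (by norm_num)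

lemma integrable_mul_of_K_lt_top (hφ : Measurable φ) (hf : Measurable f) (hT : Measurable T)
    (hh : Measurable h) (hh_nonneg : ∀ x, 0 ≤ h x) (h0 : partition T h θ ≠ 0)
    (hK : K φ f T h θ < ⊤) : Integrable fun x => φ x * f x := by
  have := isProbabilityMeasure_sampling hT hh h0 (partition_ne_top_of_K_lt_top hK)
  have hi := (memLp_two_weighted hφ hf hT hh hh_nonneg h0 hK).integrable one_le_two
  rw [integrable_sampling_iff hT hh hh_nonneg] at hi
  exact hi.congr (density_mul_weighted_ae hφ hf hT hh hK)

lemma integral_weighted (hφ : Measurable φ) (hf : Measurable f) (hT : Measurable T)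
    (hh : Measurable h) (hh_nonneg : ∀ x, 0 ≤ h x) (hK : K φ f T h θ < ⊤) :
    ∫ x, weighted φ f T h θ x ∂(sampling T h θ) = target φ f := by
  rw [integral_sampling hT hh hh_nonneg, target,
    integral_congr_ae (density_mul_weighted_ae hφ hf hT hh hK)]

lemma V_eq (hφ : Measurable φ) (hf : Measurable f) (hT : Measurable T)
    (hh : Measurable h) (hh_nonneg : ∀ x, 0 ≤ h x) (h0 : partition T h θ ≠ 0)
    (hK : K φ f T h θ < ⊤) :
    V φ f T h θ =
      ((∫ x, weighted φ f T h θ x ^ 2 ∂(sampling T h θ) - target φ f ^ 2 : ℝ) : EReal) := by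
  have hi := (memLp_two_weighted hφ hf hT hh hh_nonneg h0 hK).integrable_sq
  have hw := measurable_weighted_right hφ hf hT hh θ
  have h1 := partition_ne_top_of_K_lt_top hK
  rw [V, if_neg (by rwa [logPartition_eq_top_iff]), EReal.coe_sub]
  congr 1
  have hlin : ∫⁻ x, ENNReal.ofReal ((φ x * f x) ^ 2) / ENNReal.ofReal (density T h θ x) =
      ENNReal.ofReal (∫ x, weighted φ f T h θ x ^ 2 ∂(sampling T h θ)) := by
    rw [ofReal_integral_eq_lintegral_ofReal hi (ae_of_all _ fun x => sq_nonneg _),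
      lintegral_sampling hT hh θ (by fun_prop)]
    refine lintegral_congr_ae ?_
    filter_upwards [ae_eq_zero_of_density_eq_zero hφ hf hT hh hK] with x hx
    by_cases hd : density T h θ x = 0
    · simp [hd, hx hd]
    · have hpos : 0 < density T h θ x := (density_nonneg hh_nonneg θ x).lt_of_ne' hd
      rw [← ENNReal.ofReal_div_of_pos hpos, ← ENNReal.ofReal_mul hpos.le, weighted]
      congr 1
      field_simp
  rw [hlin, EReal.coe_ennreal_ofReal, max_eq_left (integral_nonneg fun x => sq_nonneg _)]

lemma target_sq_le (hφ : Measurable φ) (hf : Measurable f) (hT : Measurable T)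
    (hh : Measurable h) (hh_nonneg : ∀ x, 0 ≤ h x) (h0 : partition T h θ ≠ 0)
    (hK : K φ f T h θ < ⊤) :
    target φ f ^ 2 ≤ ∫ x, weighted φ f T h θ x ^ 2 ∂(sampling T h θ) := by
  have := isProbabilityMeasure_sampling hT hh h0 (partition_ne_top_of_K_lt_top hK)
  have hv := variance_eq_sub (memLp_two_weighted hφ hf hT hh hh_nonneg h0 hK)
  have hn := variance_nonneg (weighted φ f T h θ) (sampling T h θ)
  rw [hv, integral_weighted hφ hf hT hh hh_nonneg hK] at hn
  simpa using hn

/-- The second moment of the importance sampled value is convex in the parameter, with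
stochastic gradient `stochGrad`. -/
lemma integral_weighted_sq_add_inner_le (hφ : Measurable φ) (hf : Measurable f) (hT : Measurable T)
    (hh : Measurable h) (hh_nonneg : ∀ x, 0 ≤ h x) (h0 : ∀ θ, partition T h θ ≠ 0)
    (hK : ∀ᶠ t in 𝓝 θ, K φ f T h t < ⊤) (hK' : K φ f T h θ' < ⊤)
    (hg : Integrable (stochGrad φ f T h θ) (sampling T h θ)) :
    ∫ x, (weighted φ f T h θ x ^ 2 + ⟪stochGrad φ f T h θ x, θ' - θ⟫_ℝ) ∂(sampling T h θ) ≤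
      ∫ x, weighted φ f T h θ' x ^ 2 ∂(sampling T h θ') := by
  have hfin := hK.mono fun t ht => partition_ne_top_of_K_lt_top ht
  have h1 := hfin.self_of_nhds
  have h1' := partition_ne_top_of_K_lt_top hK'
  have hi := ((memLp_two_weighted hφ hf hT hh hh_nonneg (h0 θ) hK.self_of_nhds).integrable_sq).add
    (hg.inner_const (θ' - θ))
  have hi' := (memLp_two_weighted hφ hf hT hh hh_nonneg (h0 θ') hK').integrable_sq
  have hA := inner_gradLogPartition_le hT hh (h0 θ) hfin (h0 θ') h1'
  rw [integrable_sampling_iff hT hh hh_nonneg] at hi hi'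
  rw [integral_sampling hT hh hh_nonneg, integral_sampling hT hh hh_nonneg]
  refine integral_mono hi hi' fun x => ?_
  simp only [stochGrad, inner_smul_left, RCLike.conj_to_real]
  rw [weighted, weighted, density_of_ne_top h1, density_of_ne_top h1']
  by_cases hx : h x = 0
  · simp [hx]
  have hpos : 0 < h x := (hh_nonneg x).lt_of_ne' hx
  set a := ⟪θ, T x⟫_ℝ - (logPartition T h θ).toReal
  set a' := ⟪θ', T x⟫_ℝ - (logPartition T h θ').toReal
  -- Convexity enters pointwise: `1 + u ≤ eᵘ` with `u = a - a' = A(θ') - A(θ) - ⟪θ' - θ, T x⟫`, and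
  -- the gradient inequality for `A`. Thus `V` itself is never differentiated.
  have hle : 1 + ⟪gradLogPartition T h θ - T x, θ' - θ⟫_ℝ ≤ Real.exp (a - a') := by
    have e1 := Real.add_one_le_exp (a - a')
    rw [inner_sub_left, inner_sub_right (T x), real_inner_comm θ', real_inner_comm θ]
    linarith
  clear_value a a'
  calc Real.exp a * h x * ((φ x * f x / (Real.exp a * h x)) ^ 2 +
        (φ x * f x / (Real.exp a * h x)) ^ 2 * ⟪gradLogPartition T h θ - T x, θ' - θ⟫_ℝ)
      = (φ x * f x) ^ 2 / (Real.exp a * h x) *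
          (1 + ⟪gradLogPartition T h θ - T x, θ' - θ⟫_ℝ) := by
        field_simp
    _ ≤ (φ x * f x) ^ 2 / (Real.exp a * h x) * Real.exp (a - a') := by gcongr
    _ = Real.exp a' * h x * (φ x * f x / (Real.exp a' * h x)) ^ 2 := by
        rw [Real.exp_sub]
        field_simp

/-- Integrating against `f_θ` turns `‖g‖²` into the integrand of `K` weighted by `‖∇A - T‖²`. Only
an inequality holds in general: where `h = 0` the left integrand is `0`, while the right one may be
infinite. -/
lemma lintegral_stochGrad_sq_le (hφ : Measurable φ) (hf : Measurable f) (hT : Measurable T)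
    (hh : Measurable h) (hh_nonneg : ∀ x, 0 ≤ h x) (h1 : partition T h θ ≠ ⊤) :
    ∫⁻ x, ‖stochGrad φ f T h θ x‖ₑ ^ 2 ∂(sampling T h θ) ≤
      ENNReal.ofReal (Real.exp (logPartition T h θ).toReal ^ 3) *
        ∫⁻ x, ENNReal.ofReal (‖gradLogPartition T h θ - T x‖ ^ 2 *
          Real.exp ⟪θ, (-3 : ℝ) • T x⟫_ℝ) ∂(fourthMeasure φ f h) := by
  have hg := measurable_stochGrad_right hφ hf hT hh θ
  rw [fourthMeasure, lintegral_withDensity_eq_lintegral_mul _ (by fun_prop)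
    (by fun_prop), ← lintegral_const_mul _ (by fun_prop), lintegral_sampling hT hh θ (by fun_prop)]
  refine lintegral_mono fun x => ?_
  by_cases hx : h x = 0
  · simp [density_of_ne_top h1, hx]
  have hpos : 0 < h x := (hh_nonneg x).lt_of_ne' hx
  have hd := density_nonneg (T := T) hh_nonneg θ x
  rw [Pi.mul_apply, ← ofReal_norm, ← ENNReal.ofReal_pow (norm_nonneg _),
    ← ENNReal.ofReal_mul hd, ← ENNReal.ofReal_pow hpos.le,
    ← ENNReal.ofReal_div_of_pos (by positivity), ← ENNReal.ofReal_mul (by positivity),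
    ← ENNReal.ofReal_mul (by positivity)]
  refine ENNReal.ofReal_le_ofReal (le_of_eq ?_)
  rw [stochGrad, norm_smul, mul_pow, Real.norm_of_nonneg (sq_nonneg _), weighted,
    density_of_ne_top h1, inner_smul_right, Real.exp_sub, neg_mul, Real.exp_neg,
    show (3 : ℝ) * ⟪θ, T x⟫_ℝ = (3 : ℕ) * ⟪θ, T x⟫_ℝ by norm_num, Real.exp_nat_mul]
  field_simp

lemma exists_nhds_lintegral_stochGrad_sq_le (hφ : Measurable φ) (hf : Measurable f)
    (hT : Measurable T) (hh : Measurable h) (hh_nonneg : ∀ x, 0 ≤ h x)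
    (h0 : ∀ θ, partition T h θ ≠ 0) (hK : ∀ᶠ t in 𝓝 θ₀, K φ f T h t < ⊤) :
    ∃ B : ℝ, ∀ᶠ θ in 𝓝 θ₀,
      ∫⁻ x, ‖stochGrad φ f T h θ x‖ₑ ^ 2 ∂(sampling T h θ) ≤ ENNReal.ofReal B := by
  have hfin := hK.mono fun t ht => partition_ne_top_of_K_lt_top ht
  set S : Vec k → Vec p := fun x => (-3 : ℝ) • T x with hSdef
  have hS : Measurable S := by fun_prop
  obtain ⟨R, hR⟩ := eventually_norm_gradLogPartition_le hT hh h0 hfin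
  obtain ⟨ε, hε, hint⟩ := exists_integrable_exp_inner_add_norm hS
    (hK.mono fun t ht => lintegral_fourthMeasure_lt_top hφ hf hT hh ht)
  set c : ℕ → ℝ := fun n => n.factorial * (2 / ε) ^ n *
    ∫ x, Real.exp (⟪θ₀, S x⟫_ℝ + ε * ‖S x‖) ∂(fourthMeasure φ f h) with hc
  -- `R ^ 3` bounds `exp(3A)`, and `‖∇A - T‖² ≤ 2R² + ‖S‖²` because `‖S‖ = 3‖T‖`; `c 0` and `c 2`
  -- bound the matching moments of `S`.
  refine ⟨R ^ 3 * (2 * R ^ 2 * c 0 + c 2), ?_⟩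
  filter_upwards [hR, hfin, Metric.ball_mem_nhds θ₀ (half_pos hε)] with θ hθ h1 hball
  have hd : ‖θ - θ₀‖ ≤ ε / 2 := (mem_ball_iff_norm.1 hball).le
  have hR0 : 0 ≤ R := (Real.exp_pos _).le.trans hθ.1
  have hi0 := integrable_norm_pow_mul_exp_inner hS hε hint hd 0
  have hi2 := integrable_norm_pow_mul_exp_inner hS hε hint hd 2
  refine (lintegral_stochGrad_sq_le hφ hf hT hh hh_nonneg h1).trans ?_
  rw [ENNReal.ofReal_mul (by positivity)]
  refine mul_le_mul' (ENNReal.ofReal_le_ofReal (pow_le_pow_left₀ (Real.exp_pos _).le hθ.1 3)) ?_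
  calc _ ≤ ∫⁻ x, ENNReal.ofReal (2 * R ^ 2 * (‖S x‖ ^ 0 * Real.exp ⟪θ, S x⟫_ℝ) +
        ‖S x‖ ^ 2 * Real.exp ⟪θ, S x⟫_ℝ) ∂(fourthMeasure φ f h) := by
        refine lintegral_mono fun x => ENNReal.ofReal_le_ofReal ?_
        have hST : ‖S x‖ = 3 * ‖T x‖ := by simp [hSdef, norm_smul]
        have hsub := norm_sub_le (gradLogPartition T h θ) (T x)
        have hsq : ‖gradLogPartition T h θ - T x‖ ^ 2 ≤ 2 * R ^ 2 + ‖S x‖ ^ 2 := by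
          rw [hST]
          have h2 : ‖gradLogPartition T h θ - T x‖ ≤ R + ‖T x‖ := hsub.trans (by linarith [hθ.2])
          have h3 := pow_le_pow_left₀ (norm_nonneg _) h2 2
          nlinarith [sq_nonneg (R - ‖T x‖), sq_nonneg ‖T x‖]
        rw [pow_zero, one_mul, ← add_mul]
        exact mul_le_mul_of_nonneg_right hsq (Real.exp_pos _).le
    _ = ENNReal.ofReal (∫ x, (2 * R ^ 2 * (‖S x‖ ^ 0 * Real.exp ⟪θ, S x⟫_ℝ) +
        ‖S x‖ ^ 2 * Real.exp ⟪θ, S x⟫_ℝ) ∂(fourthMeasure φ f h)) :=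
        (ofReal_integral_eq_lintegral_ofReal ((hi0.const_mul _).add hi2)
          (ae_of_all _ fun x => add_nonneg (mul_nonneg (by positivity)
            (mul_nonneg (by positivity) (Real.exp_pos _).le))
            (mul_nonneg (by positivity) (Real.exp_pos _).le))).symm
    _ ≤ _ := by
        refine ENNReal.ofReal_le_ofReal ?_
        rw [integral_add (hi0.const_mul _) hi2, integral_const_mul]
        exact add_le_add (mul_le_mul_of_nonneg_left
          (integral_norm_pow_mul_exp_inner_le hS hε hint hd 0) (by positivity))
          (integral_norm_pow_mul_exp_inner_le hS hε hint hd 2)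

lemma GSq_lt_top (hφ : Measurable φ) (hf : Measurable f)
    (hT : Measurable T) (hh : Measurable h) (hh_nonneg : ∀ x, 0 ≤ h x)
    (h0 : ∀ θ, partition T h θ ≠ 0) {Θ : Set (Vec p)}
    (hΘ_sub : Θ ⊆ interior {θ | K φ f T h θ < ⊤}) (hΘ_comp : IsCompact Θ) :
    GSq φ f T h Θ < ⊤ := by
  refine hΘ_comp.induction_on (p := fun s => GSq φ f T h s < ⊤) (by simp [GSq])
    (fun s t hst ht => (biSup_mono fun θ hθ => hst hθ).trans_lt ht)
    (fun s t hs ht => by rw [GSq, iSup_union]; exact sup_lt_iff.2 ⟨hs, ht⟩) fun θ hθ => ?_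
  obtain ⟨B, hB⟩ := exists_nhds_lintegral_stochGrad_sq_le hφ hf hT hh hh_nonneg h0
    (mem_interior_iff_mem_nhds.1 (hΘ_sub hθ))
  exact ⟨_, mem_nhdsWithin_of_mem_nhds hB,
    (iSup₂_le fun θ hθ => hθ : GSq φ f T h _ ≤ ENNReal.ofReal B).trans_lt ENNReal.ofReal_lt_top⟩

end ImportanceSampling

/-! ### Euclidean projection onto a compact convex set -/

section Projection

variable {Θ : Set (Vec p)}

lemma proj_spec (hne : Θ.Nonempty) (hcomp : IsCompact Θ) (u : Vec p) :
    proj Θ u ∈ Θ ∧ ∀ w ∈ Θ, ‖u - proj Θ u‖ ≤ ‖u - w‖ := by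
  obtain ⟨v, hv, hmin⟩ := hcomp.exists_isMinOn hne
    (f := fun w => ‖u - w‖) (by fun_prop : Continuous fun w => ‖u - w‖).continuousOn
  exact Classical.epsilon_spec (p := fun v => v ∈ Θ ∧ ∀ w ∈ Θ, ‖u - v‖ ≤ ‖u - w‖)
    ⟨v, hv, fun w hw => hmin hw⟩

lemma inner_sub_proj_le_zero (hne : Θ.Nonempty) (hconv : Convex ℝ Θ) (hcomp : IsCompact Θ)
    (u : Vec p) {w : Vec p} (hw : w ∈ Θ) : ⟪u - proj Θ u, w - proj Θ u⟫_ℝ ≤ 0 := by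
  obtain ⟨hmem, hmin⟩ := proj_spec hne hcomp u
  refine (norm_eq_iInf_iff_real_inner_le_zero hconv hmem).1 ?_ w hw
  have : Nonempty Θ := hne.to_subtype
  refine le_antisymm (le_ciInf fun w => hmin w w.2) ?_
  exact ciInf_le (f := fun w : Θ => ‖u - w‖) ⟨0, by rintro _ ⟨w, rfl⟩; exact norm_nonneg _⟩
    ⟨proj Θ u, hmem⟩

/-- Adding the variational inequalities at `u` and `v` gives `‖a - b‖² ≤ ⟪u - v, a - b⟫` for the
projections `a`, `b`; then Cauchy–Schwarz. -/
lemma norm_proj_sub_proj_le (hne : Θ.Nonempty) (hconv : Convex ℝ Θ) (hcomp : IsCompact Θ)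
    (u v : Vec p) : ‖proj Θ u - proj Θ v‖ ≤ ‖u - v‖ := by
  have h1 := inner_sub_proj_le_zero hne hconv hcomp u (proj_spec hne hcomp v).1
  have h2 := inner_sub_proj_le_zero hne hconv hcomp v (proj_spec hne hcomp u).1
  set a := proj Θ u
  set b := proj Θ v
  have h3 : ‖a - b‖ * ‖a - b‖ ≤ ⟪u - v, a - b⟫_ℝ := by
    rw [← real_inner_self_eq_norm_mul_norm]
    simp only [inner_sub_left, inner_sub_right, real_inner_comm] at h1 h2 ⊢
    linarith
  have h4 := h3.trans (real_inner_le_norm _ _)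
  by_contra! hlt
  nlinarith [norm_nonneg (u - v)]

lemma continuous_proj (hne : Θ.Nonempty) (hconv : Convex ℝ Θ) (hcomp : IsCompact Θ) :
    Continuous (proj Θ) :=
  (LipschitzWith.of_dist_le_mul (K := 1) fun u v => by
    simpa [dist_eq_norm] using norm_proj_sub_proj_le hne hconv hcomp u v).continuous

lemma norm_proj_sub_le (hne : Θ.Nonempty) (hconv : Convex ℝ Θ) (hcomp : IsCompact Θ)
    (u : Vec p) {w : Vec p} (hw : w ∈ Θ) : ‖proj Θ u - w‖ ≤ ‖u - w‖ := by
  have h0 : proj Θ w = w := by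
    have := (proj_spec hne hcomp w).2 w hw
    rw [sub_self, norm_zero, norm_le_zero_iff, sub_eq_zero] at this
    exact this.symm
  simpa [h0] using norm_proj_sub_proj_le hne hconv hcomp u w

end Projection

/-- The standing assumptions on the integrand, the exponential family and the parameter set. -/
structure Admissible (φ f : Vec k → ℝ) (T : Vec k → Vec p) (h : Vec k → ℝ)
    (Θ : Set (Vec p)) : Prop where
  measurable_integrand : Measurable φ
  measurable_nominal : Measurable f
  measurable_stat : Measurable T
  measurable_base : Measurable h
  base_nonneg : ∀ x, 0 ≤ h x
  partition_ne_zero : ∀ θ, partition T h θ ≠ 0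
  subset_interior : Θ ⊆ interior {θ | K φ f T h θ < ⊤}
  nonempty : Θ.Nonempty
  convex : Convex ℝ Θ
  isCompact : IsCompact Θ

variable {φ f : Vec k → ℝ} {T : Vec k → Vec p} {h : Vec k → ℝ} {Θ : Set (Vec p)}
  {C : ℝ} {θ₁ θ θ' : Vec p}

/-! ### Bounds uniform over the parameter set -/

namespace Admissible

lemma eventually_K_lt_top (A : Admissible φ f T h Θ) (hθ : θ ∈ Θ) :
    ∀ᶠ t in 𝓝 θ, K φ f T h t < ⊤ :=
  mem_interior_iff_mem_nhds.1 (A.subset_interior hθ)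

lemma K_lt_top (A : Admissible φ f T h Θ) (hθ : θ ∈ Θ) : K φ f T h θ < ⊤ :=
  (A.eventually_K_lt_top hθ).self_of_nhds

lemma isProbabilityMeasure_sampling (A : Admissible φ f T h Θ) (hθ : θ ∈ Θ) :
    IsProbabilityMeasure (sampling T h θ) :=
  ConvexAdaMC.isProbabilityMeasure_sampling A.measurable_stat A.measurable_base
    (A.partition_ne_zero θ) (partition_ne_top_of_K_lt_top (A.K_lt_top hθ))

lemma memLp_two_weighted (A : Admissible φ f T h Θ) (hθ : θ ∈ Θ) :
    MemLp (weighted φ f T h θ) 2 (sampling T h θ) :=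
  ConvexAdaMC.memLp_two_weighted A.measurable_integrand A.measurable_nominal A.measurable_stat
    A.measurable_base A.base_nonneg (A.partition_ne_zero θ) (A.K_lt_top hθ)

lemma integral_weighted (A : Admissible φ f T h Θ) (hθ : θ ∈ Θ) :
    ∫ x, weighted φ f T h θ x ∂(sampling T h θ) = target φ f :=
  ConvexAdaMC.integral_weighted A.measurable_integrand A.measurable_nominal A.measurable_stat
    A.measurable_base A.base_nonneg (A.K_lt_top hθ)

lemma V_eq (A : Admissible φ f T h Θ) (hθ : θ ∈ Θ) : V φ f T h θ =
    ((∫ x, weighted φ f T h θ x ^ 2 ∂(sampling T h θ) - target φ f ^ 2 : ℝ) : EReal) :=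
  ConvexAdaMC.V_eq A.measurable_integrand A.measurable_nominal A.measurable_stat
    A.measurable_base A.base_nonneg (A.partition_ne_zero θ) (A.K_lt_top hθ)

lemma target_sq_le (A : Admissible φ f T h Θ) (hθ : θ ∈ Θ) :
    target φ f ^ 2 ≤ ∫ x, weighted φ f T h θ x ^ 2 ∂(sampling T h θ) :=
  ConvexAdaMC.target_sq_le A.measurable_integrand A.measurable_nominal A.measurable_stat
    A.measurable_base A.base_nonneg (A.partition_ne_zero θ) (A.K_lt_top hθ)

lemma GSq_lt_top (A : Admissible φ f T h Θ) : GSq φ f T h Θ < ⊤ :=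
  ConvexAdaMC.GSq_lt_top A.measurable_integrand A.measurable_nominal A.measurable_stat
    A.measurable_base A.base_nonneg A.partition_ne_zero A.subset_interior A.isCompact

lemma measurable_weighted (A : Admissible φ f T h Θ) :
    Measurable fun q : Vec p × Vec k => weighted φ f T h q.1 q.2 :=
  ConvexAdaMC.measurable_weighted A.measurable_integrand A.measurable_nominal A.measurable_stat
    A.measurable_base

lemma measurable_stochGrad (A : Admissible φ f T h Θ) :
    Measurable fun q : Vec p × Vec k => stochGrad φ f T h q.1 q.2 :=
  ConvexAdaMC.measurable_stochGrad A.measurable_integrand A.measurable_nominal A.measurable_stat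
    A.measurable_base

lemma lintegral_stochGrad_sq_le (hθ : θ ∈ Θ) :
    ∫⁻ x, ‖stochGrad φ f T h θ x‖ₑ ^ 2 ∂(sampling T h θ) ≤ GSq φ f T h Θ :=
  le_iSup₂_of_le (f := fun θ (_ : θ ∈ Θ) =>
    ∫⁻ x, ‖stochGrad φ f T h θ x‖ₑ ^ 2 ∂(sampling T h θ)) θ hθ le_rfl

lemma memLp_two_stochGrad (A : Admissible φ f T h Θ) (hθ : θ ∈ Θ) :
    MemLp (stochGrad φ f T h θ) 2 (sampling T h θ) := by
  have hg := measurable_stochGrad_right A.measurable_integrand A.measurable_nominal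
    A.measurable_stat A.measurable_base θ
  refine ⟨hg.aestronglyMeasurable, ?_⟩
  rw [eLpNorm_lt_top_iff_lintegral_rpow_enorm_lt_top (by norm_num) (by norm_num)]
  simpa using (lintegral_stochGrad_sq_le hθ).trans_lt A.GSq_lt_top

lemma integral_norm_stochGrad_sq_le (A : Admissible φ f T h Θ) (hθ : θ ∈ Θ) :
    ∫ x, ‖stochGrad φ f T h θ x‖ ^ 2 ∂(sampling T h θ) ≤ (GSq φ f T h Θ).toReal := by
  rw [integral_eq_lintegral_of_nonneg_ae (ae_of_all _ fun x => sq_nonneg _)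
    ((A.memLp_two_stochGrad hθ).1.norm.pow 2)]
  refine ENNReal.toReal_mono A.GSq_lt_top.ne (le_trans (le_of_eq ?_) (lintegral_stochGrad_sq_le hθ))
  refine lintegral_congr fun x => ?_
  rw [ENNReal.ofReal_pow (norm_nonneg _), ofReal_norm]

lemma integral_weighted_sq_sub_inner_le (A : Admissible φ f T h Θ) (hθ : θ ∈ Θ) (hθ' : θ' ∈ Θ) :
    ∫ x, (weighted φ f T h θ x ^ 2 - ⟪stochGrad φ f T h θ x, θ - θ'⟫_ℝ) ∂(sampling T h θ) ≤
      ∫ x, weighted φ f T h θ' x ^ 2 ∂(sampling T h θ') := by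
  have := A.isProbabilityMeasure_sampling hθ
  have key := integral_weighted_sq_add_inner_le A.measurable_integrand A.measurable_nominal
    A.measurable_stat A.measurable_base A.base_nonneg A.partition_ne_zero (A.eventually_K_lt_top hθ)
    (A.K_lt_top hθ') ((A.memLp_two_stochGrad hθ).integrable one_le_two)
  simpa only [sub_eq_add_neg, ← inner_neg_right, neg_add, neg_neg, add_comm] using key

/-- The subgradient inequality against one fixed `θ'`, with `ab ≤ a² + b²`, bounds the second moment
by its value at `θ'` plus `G² + D²`; no continuity of `V` is needed. -/
lemma exists_integral_weighted_sq_le (A : Admissible φ f T h Θ) :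
    ∃ B, ∀ θ ∈ Θ, ∫ x, weighted φ f T h θ x ^ 2 ∂(sampling T h θ) ≤ B := by
  obtain ⟨θ', hθ'⟩ := A.nonempty
  refine ⟨∫ x, weighted φ f T h θ' x ^ 2 ∂(sampling T h θ') +
    ((GSq φ f T h Θ).toReal + Metric.diam Θ ^ 2), fun θ hθ => ?_⟩
  have := A.isProbabilityMeasure_sampling hθ
  have hg := A.memLp_two_stochGrad hθ
  have hw := (A.memLp_two_weighted hθ).integrable_sq
  have hi : Integrable (fun x => ⟪stochGrad φ f T h θ x, θ - θ'⟫_ℝ) (sampling T h θ) :=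
    (hg.integrable one_le_two).inner_const _
  have key := A.integral_weighted_sq_sub_inner_le hθ hθ'
  rw [integral_sub hw hi] at key
  have hle : ∫ x, ⟪stochGrad φ f T h θ x, θ - θ'⟫_ℝ ∂(sampling T h θ) ≤
      ∫ x, (‖stochGrad φ f T h θ x‖ ^ 2 + Metric.diam Θ ^ 2) ∂(sampling T h θ) := by
    refine integral_mono hi (hg.integrable_norm_pow'.add (integrable_const _)) fun x => ?_
    have hD : ‖θ - θ'‖ ≤ Metric.diam Θ := by
      rw [← dist_eq_norm]; exact Metric.dist_le_diam_of_mem A.isCompact.isBounded hθ hθ'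
    have h1 := real_inner_le_norm (stochGrad φ f T h θ x) (θ - θ')
    show _ ≤ ‖stochGrad φ f T h θ x‖ ^ 2 + Metric.diam Θ ^ 2
    nlinarith [sq_nonneg (‖stochGrad φ f T h θ x‖ - ‖θ - θ'‖), norm_nonneg (θ - θ'),
      norm_nonneg (stochGrad φ f T h θ x)]
  rw [integral_add hg.integrable_norm_pow' (integrable_const _)] at hle
  have hG := A.integral_norm_stochGrad_sq_le hθ
  simp at hle
  linarith

end Admissible

/-! ### The parameter recursion and its regret along a fixed path -/

section Parameters

lemma params_mem (hne : Θ.Nonempty) (hcomp : IsCompact Θ) (hθ₁ : θ₁ ∈ Θ) (x : ℕ → Vec k) :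
    ∀ i, params φ f T h Θ C θ₁ x i ∈ Θ
  | 0 => hθ₁
  | _ + 1 => (proj_spec hne hcomp _).1

/-- Adaptedness: parameter `i` sees only the samples strictly before `i`. -/
lemma params_congr {x y : ℕ → Vec k} : ∀ {i : ℕ}, (∀ j < i, x j = y j) →
    params φ f T h Θ C θ₁ x i = params φ f T h Θ C θ₁ y i
  | 0, _ => rfl
  | i + 1, hxy => by
    rw [params, params, params_congr (i := i) fun j hj => hxy j (hj.trans i.lt_succ_self),
      hxy i i.lt_succ_self]

lemma measurable_params (A : Admissible φ f T h Θ) :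
    ∀ i, Measurable fun x : ℕ → Vec k => params φ f T h Θ C θ₁ x i
  | 0 => measurable_const
  | i + 1 => by
    have ih := measurable_params A i
    have hg : Measurable fun x : ℕ → Vec k =>
        stochGrad φ f T h (params φ f T h Θ C θ₁ x i) (x i) :=
      A.measurable_stochGrad.comp (ih.prodMk (measurable_pi_apply i))
    exact (continuous_proj A.nonempty A.convex A.isCompact).measurable.comp
      (ih.sub (hg.fun_const_smul (C / √((i : ℝ) + 1))))

/-- The regret bound of projected gradient descent, path by path. -/
lemma sum_inner_stochGrad_le (A : Admissible φ f T h Θ) (hC : 0 < C) (hθ₁ : θ₁ ∈ Θ) (hθ' : θ' ∈ Θ)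
    (x : ℕ → Vec k) (n : ℕ) :
    ∑ i ∈ Finset.range n, ⟪stochGrad φ f T h (params φ f T h Θ C θ₁ x i) (x i),
        params φ f T h Θ C θ₁ x i - θ'⟫_ℝ ≤
      Metric.diam Θ ^ 2 * √n / (2 * C) +
        ∑ i ∈ Finset.range n, C / (2 * √((i : ℝ) + 1)) *
          ‖stochGrad φ f T h (params φ f T h Θ C θ₁ x i) (x i)‖ ^ 2 := by
  set t : ℕ → Vec p := params φ f T h Θ C θ₁ x
  set g : ℕ → Vec p := fun i => stochGrad φ f T h (t i) (x i)
  set D := Metric.diam Θ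
  have hdist : ∀ i, ‖t i - θ'‖ ^ 2 ≤ D ^ 2 := fun i => by
    refine pow_le_pow_left₀ (norm_nonneg _) ?_ 2
    rw [← dist_eq_norm]
    exact Metric.dist_le_diam_of_mem A.isCompact.isBounded
      (params_mem A.nonempty A.isCompact hθ₁ x i) hθ'
  -- Projecting does not increase the distance to `θ' ∈ Θ`; expand the squared distance after the
  -- unprojected step and solve for the inner product.
  have hstep : ∀ i : ℕ, ⟪g i, t i - θ'⟫_ℝ ≤
      √((i : ℝ) + 1) / (2 * C) * (‖t i - θ'‖ ^ 2 - ‖t (i + 1) - θ'‖ ^ 2) +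
        C / (2 * √((i : ℝ) + 1)) * ‖g i‖ ^ 2 := fun i => by
    have hs : 0 < √((i : ℝ) + 1) := Real.sqrt_pos.2 (by positivity)
    set s := √((i : ℝ) + 1)
    have h1 : ‖t (i + 1) - θ'‖ ^ 2 ≤ ‖(t i - θ') - (C / s) • g i‖ ^ 2 := by
      refine pow_le_pow_left₀ (norm_nonneg _) ?_ 2
      rw [sub_right_comm]
      exact norm_proj_sub_le A.nonempty A.convex A.isCompact _ hθ'
    rw [norm_sub_sq_real (t i - θ'), inner_smul_right, norm_smul, real_inner_comm, mul_pow,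
      Real.norm_of_nonneg (by positivity)] at h1
    have h2 : ⟪g i, t i - θ'⟫_ℝ = s / (2 * C) * (2 * (C / s * ⟪g i, t i - θ'⟫_ℝ)) := by field_simp
    have h3 : C / (2 * s) * ‖g i‖ ^ 2 = s / (2 * C) * ((C / s) ^ 2 * ‖g i‖ ^ 2) := by field_simp
    rw [h2, h3, ← mul_add]
    exact mul_le_mul_of_nonneg_left (by linarith) (by positivity)
  -- Summation by parts: the weights `√(i+1)` increase and each squared distance is at most `D²`.
  -- The term `-‖t n - θ'‖²` is kept so that the induction closes.
  have htel : ∀ n : ℕ, ∑ i ∈ Finset.range n,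
      √((i : ℝ) + 1) / (2 * C) * (‖t i - θ'‖ ^ 2 - ‖t (i + 1) - θ'‖ ^ 2) ≤
        √n / (2 * C) * (D ^ 2 - ‖t n - θ'‖ ^ 2) := fun n => by
    induction n with
    | zero => simp
    | succ n ih =>
      rw [Finset.sum_range_succ]
      push_cast
      have hmono : √(n : ℝ) / (2 * C) ≤ √((n : ℝ) + 1) / (2 * C) :=
        div_le_div_of_nonneg_right (Real.sqrt_le_sqrt (by linarith)) (by positivity)
      nlinarith [hdist n]
  have hlast : √n / (2 * C) * (D ^ 2 - ‖t n - θ'‖ ^ 2) ≤ D ^ 2 * √n / (2 * C) := by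
    rw [mul_comm (D ^ 2), ← div_mul_eq_mul_div]
    exact mul_le_mul_of_nonneg_left (by linarith [sq_nonneg ‖t n - θ'‖]) (by positivity)
  calc _ ≤ _ := Finset.sum_le_sum fun i _ => hstep i
    _ = _ := Finset.sum_add_distrib
    _ ≤ _ := add_le_add_left ((htel n).trans hlast) _

lemma sum_inv_sqrt_le (n : ℕ) : ∑ i ∈ Finset.range n, 1 / (2 * √((i : ℝ) + 1)) ≤ √n := by
  induction n with
  | zero => simp
  | succ n ih =>
    rw [Finset.sum_range_succ]
    push_cast
    have hs : 0 < √((n : ℝ) + 1) := Real.sqrt_pos.2 (by positivity)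
    have hle : √(n : ℝ) ≤ √((n : ℝ) + 1) := Real.sqrt_le_sqrt (by linarith)
    have h1 : 1 / (2 * √((n : ℝ) + 1)) ≤ √((n : ℝ) + 1) - √n := by
      rw [div_le_iff₀ (by positivity)]
      have e1 := Real.mul_self_sqrt (show (0 : ℝ) ≤ n + 1 by positivity)
      have e2 := Real.mul_self_sqrt (show (0 : ℝ) ≤ n by positivity)
      nlinarith [Real.sqrt_nonneg (n : ℝ)]
    linarith

end Parameters

end ConvexAdaMC

/-! ### The joint law of the past and the next sample -/

namespace ConvexAdaMC

open Filter Topology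

variable {k p : ℕ} {φ f : Vec k → ℝ} {T : Vec k → Vec p} {h : Vec k → ℝ} {Θ : Set (Vec p)}
  {C : ℝ} {θ₁ θ θ' : Vec p} {Ω : Type*} {X : ℕ → Ω → Vec k}

/-- The samples before time `i`, as a sequence extended by zero. -/
def history (X : ℕ → Ω → Vec k) (i : ℕ) (ω : Ω) : ℕ → Vec k := fun j => if j < i then X j ω else 0

lemma history_of_lt {i j : ℕ} (hj : j < i) (ω : Ω) : history X i ω j = X j ω := if_pos hj

lemma params_history (i : ℕ) (ω : Ω) {j : ℕ} (hj : j ≤ i) :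
    params φ f T h Θ C θ₁ (history X i ω) j = params φ f T h Θ C θ₁ (fun j => X j ω) j :=
  params_congr fun _ hl => history_of_lt (hl.trans_le hj) ω

lemma measurable_history_past (X : ℕ → Ω → Vec k) (i : ℕ) : Measurable[past X i] (history X i) := by
  refine @measurable_pi_lambda _ _ _ (past X i) _ _ fun j => ?_
  by_cases hj : j < i
  · have : Measurable[past X i] (X j) :=
      (comap_measurable (X j)).mono (le_iSup₂_of_le j hj le_rfl) le_rfl
    simpa [history, hj]
  · simp [history, hj]

/-- The sampling distribution at time `i`, as a kernel from sample paths. -/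
noncomputable def samplingKernel (A : Admissible φ f T h Θ) (C : ℝ) (θ₁ : Vec p) (i : ℕ) :
    Kernel (ℕ → Vec k) (Vec k) where
  toFun x := sampling T h (params φ f T h Θ C θ₁ x i)
  measurable' := by
    refine Measure.measurable_of_measurable_coe _ fun s hs => ?_
    simp only [sampling, withDensity_apply _ hs]
    have hd : Measurable fun q : Vec p × Vec k => ENNReal.ofReal (density T h q.1 q.2) :=
      (measurable_density A.measurable_stat A.measurable_base).ennreal_ofReal
    exact (Measurable.lintegral_prod_right' (ν := volume.restrict s) hd).comp
      (measurable_params A i)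

lemma isMarkovKernel_samplingKernel (A : Admissible φ f T h Θ) (hθ₁ : θ₁ ∈ Θ) (i : ℕ) :
    IsMarkovKernel (samplingKernel A C θ₁ i) :=
  ⟨fun x => A.isProbabilityMeasure_sampling (params_mem A.nonempty A.isCompact hθ₁ x i)⟩

/-- The importance sampled value at time `i` along a sample path. -/
noncomputable def pathWeighted (φ f : Vec k → ℝ) (T : Vec k → Vec p) (h : Vec k → ℝ)
    (Θ : Set (Vec p)) (C : ℝ) (θ₁ : Vec p) (x : ℕ → Vec k) (i : ℕ) : ℝ :=
  weighted φ f T h (params φ f T h Θ C θ₁ x i) (x i)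

/-- The stochastic gradient at time `i` along a sample path. -/
noncomputable def pathGrad (φ f : Vec k → ℝ) (T : Vec k → Vec p) (h : Vec k → ℝ)
    (Θ : Set (Vec p)) (C : ℝ) (θ₁ : Vec p) (x : ℕ → Vec k) (i : ℕ) : Vec p :=
  stochGrad φ f T h (params φ f T h Θ C θ₁ x i) (x i)

lemma measurable_pathWeighted (A : Admissible φ f T h Θ) (i : ℕ) :
    Measurable fun x => pathWeighted φ f T h Θ C θ₁ x i :=
  A.measurable_weighted.comp ((measurable_params A i).prodMk (measurable_pi_apply i))

lemma measurable_pathGrad (A : Admissible φ f T h Θ) (i : ℕ) :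
    Measurable fun x => pathGrad φ f T h Θ C θ₁ x i :=
  A.measurable_stochGrad.comp ((measurable_params A i).prodMk (measurable_pi_apply i))

lemma pathWeighted_eq (i : ℕ) (ω : Ω) :
    pathWeighted φ f T h Θ C θ₁ (fun j => X j ω) i =
      weighted φ f T h (params φ f T h Θ C θ₁ (history X i ω) i) (X i ω) := by
  rw [pathWeighted, params_history i ω le_rfl]

lemma pathGrad_eq (i : ℕ) (ω : Ω) :
    pathGrad φ f T h Θ C θ₁ (fun j => X j ω) i =
      stochGrad φ f T h (params φ f T h Θ C θ₁ (history X i ω) i) (X i ω) := by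
  rw [pathGrad, params_history i ω le_rfl]

lemma pathWeighted_history {i j : ℕ} (hj : j < i) (ω : Ω) :
    pathWeighted φ f T h Θ C θ₁ (history X i ω) j =
      pathWeighted φ f T h Θ C θ₁ (fun j => X j ω) j := by
  rw [pathWeighted, pathWeighted, params_history i ω hj.le, history_of_lt hj]

lemma measurable_weighted_params (A : Admissible φ f T h Θ) (i : ℕ) :
    Measurable fun q : (ℕ → Vec k) × Vec k =>
      weighted φ f T h (params φ f T h Θ C θ₁ q.1 i) q.2 := by
  simpa only [Function.comp_def] using A.measurable_weighted.comp
    (((measurable_params A (C := C) (θ₁ := θ₁) i).comp measurable_fst).prodMk measurable_snd)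

lemma measurable_stochGrad_params (A : Admissible φ f T h Θ) (i : ℕ) :
    Measurable fun q : (ℕ → Vec k) × Vec k =>
      stochGrad φ f T h (params φ f T h Θ C θ₁ q.1 i) q.2 := by
  simpa only [Function.comp_def] using A.measurable_stochGrad.comp
    (((measurable_params A (C := C) (θ₁ := θ₁) i).comp measurable_fst).prodMk measurable_snd)

variable [MeasurableSpace Ω] {P : Measure Ω}

namespace IsRun

lemma past_le (hX : IsRun P φ f T h Θ C θ₁ X) (i : ℕ) : past X i ≤ ‹MeasurableSpace Ω› :=
  iSup₂_le fun j _ => (hX.measurable j).comap_le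

lemma measurable_history (hX : IsRun P φ f T h Θ C θ₁ X) (i : ℕ) : Measurable (history X i) :=
  (measurable_history_past X i).mono (hX.past_le i) le_rfl

/-- The joint law of the past samples and the current one. -/
lemma map_history_prodMk [IsProbabilityMeasure P] (hX : IsRun P φ f T h Θ C θ₁ X)
    (A : Admissible φ f T h Θ) (hθ₁ : θ₁ ∈ Θ) (i : ℕ) :
    P.map (fun ω => (history X i ω, X i ω)) =
      (P.map (history X i)) ⊗ₘ (samplingKernel A C θ₁ i) := by
  have := isMarkovKernel_samplingKernel (C := C) A hθ₁ i
  have hH := hX.measurable_history i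
  have := Measure.isProbabilityMeasure_map (μ := P) hH.aemeasurable
  have := Measure.isProbabilityMeasure_map (μ := P) (hH.prodMk (hX.measurable i)).aemeasurable
  -- Rectangles determine the measure. On `s ×ˢ t` both sides are the probability that the history
  -- lies in `s` and `X i` in `t`, obtained by integrating `cond_dist` over a past event.
  refine Measure.ext_prod fun {s t} hs ht => ?_
  have hs' : MeasurableSet[past X i] (history X i ⁻¹' s) := measurable_history_past X i hs
  have ht' := hX.measurable i ht
  rw [Measure.map_apply (hH.prodMk (hX.measurable i)) (hs.prod ht),
    Measure.compProd_apply_prod hs ht, setLIntegral_map hs (Kernel.measurable_coe _ ht) hH]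
  have hpre : (fun ω => (history X i ω, X i ω)) ⁻¹' s ×ˢ t = (X i ⁻¹' t) ∩ (history X i ⁻¹' s) := by
    ext ω; simp [and_comm]
  have hreal : ∫ ω in history X i ⁻¹' s, (samplingKernel A C θ₁ i (history X i ω)).real t ∂P =
      P.real ((X i ⁻¹' t) ∩ (history X i ⁻¹' s)) := by
    have hc := setIntegral_condExp (μ := P) (hX.past_le i)
      (f := (X i ⁻¹' t).indicator fun _ => (1 : ℝ))
      ((integrable_const 1).indicator ht') hs'
    rw [setIntegral_indicator ht', setIntegral_const, smul_eq_mul, mul_one, inter_comm] at hc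
    rw [← hc]
    refine setIntegral_congr_ae (hH hs) ?_
    filter_upwards [hX.cond_dist i t ht] with ω hω _
    rw [hω, ← params_history i ω le_rfl]
    rfl
  rw [hpre, ← ofReal_measureReal, ← hreal, ofReal_integral_eq_lintegral_ofReal]
  · exact lintegral_congr fun ω => ofReal_measureReal
  · refine Integrable.of_bound (C := 1) ?_ (ae_of_all _ fun ω => ?_)
    · exact ((Kernel.measurable_coe _ ht).comp hH).ennreal_toReal.aestronglyMeasurable
    · rw [Real.norm_of_nonneg measureReal_nonneg]
      exact measureReal_le_one
  · exact ae_of_all _ fun ω => measureReal_nonneg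

lemma lintegral_eq [IsProbabilityMeasure P] (hX : IsRun P φ f T h Θ C θ₁ X)
    (A : Admissible φ f T h Θ) (hθ₁ : θ₁ ∈ Θ) (i : ℕ) {F : (ℕ → Vec k) × Vec k → ℝ≥0∞}
    (hF : Measurable F) :
    ∫⁻ ω, F (history X i ω, X i ω) ∂P =
      ∫⁻ s, ∫⁻ x, F (s, x) ∂(sampling T h (params φ f T h Θ C θ₁ s i)) ∂(P.map (history X i)) := by
  have := isMarkovKernel_samplingKernel (C := C) A hθ₁ i
  have hH := hX.measurable_history i
  rw [← lintegral_map hF (hH.prodMk (hX.measurable i)), hX.map_history_prodMk A hθ₁,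
    Measure.lintegral_compProd hF]
  rfl

lemma integral_eq [IsProbabilityMeasure P] (hX : IsRun P φ f T h Θ C θ₁ X)
    (A : Admissible φ f T h Θ) (hθ₁ : θ₁ ∈ Θ) (i : ℕ) {F : (ℕ → Vec k) × Vec k → ℝ}
    (hF : Measurable F) (hi : Integrable (fun ω => F (history X i ω, X i ω)) P) :
    Integrable (fun s => ∫ x, F (s, x) ∂(sampling T h (params φ f T h Θ C θ₁ s i)))
        (P.map (history X i)) ∧
      ∫ ω, F (history X i ω, X i ω) ∂P =
        ∫ s, ∫ x, F (s, x) ∂(sampling T h (params φ f T h Θ C θ₁ s i)) ∂(P.map (history X i)) := by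
  have := isMarkovKernel_samplingKernel (C := C) A hθ₁ i
  have hHX := (hX.measurable_history i).prodMk (hX.measurable i)
  have := Measure.isProbabilityMeasure_map (μ := P) (hX.measurable_history i).aemeasurable
  have hi' : Integrable F ((P.map (history X i)) ⊗ₘ (samplingKernel A C θ₁ i)) := by
    rw [← hX.map_history_prodMk A hθ₁]
    exact (integrable_map_measure hF.aestronglyMeasurable hHX.aemeasurable).2 hi
  refine ⟨?_, ?_⟩
  · rw [Measure.compProd] at hi'
    exact hi'.integral_compProd
  · rw [← integral_map (f := F) hHX.aemeasurable hF.aestronglyMeasurable,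
      hX.map_history_prodMk A hθ₁, Measure.integral_compProd hi']
    rfl

end IsRun

/-! ### Moments, orthogonality and expected regret along a run -/

namespace IsRun

lemma measurable_path (hX : IsRun P φ f T h Θ C θ₁ X) : Measurable fun ω => fun j => X j ω :=
  measurable_pi_lambda _ fun j => hX.measurable j

variable [IsProbabilityMeasure P]

lemma memLp_pathWeighted (hX : IsRun P φ f T h Θ C θ₁ X)
    (A : Admissible φ f T h Θ) (hθ₁ : θ₁ ∈ Θ) (i : ℕ) :
    MemLp (fun ω => pathWeighted φ f T h Θ C θ₁ (fun j => X j ω) i) 2 P := by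
  refine ⟨((measurable_pathWeighted A i).comp hX.measurable_path).aestronglyMeasurable, ?_⟩
  have := Measure.isProbabilityMeasure_map (μ := P) (hX.measurable_history i).aemeasurable
  obtain ⟨B, hB⟩ := A.exists_integral_weighted_sq_le
  rw [eLpNorm_lt_top_iff_lintegral_rpow_enorm_lt_top (by norm_num) (by norm_num)]
  simp only [pathWeighted_eq]
  have hm := measurable_weighted_params A (C := C) (θ₁ := θ₁) i
  have key := hX.lintegral_eq A hθ₁ i
    (F := fun q => ‖weighted φ f T h (params φ f T h Θ C θ₁ q.1 i) q.2‖ₑ ^ (2 : ℝ≥0∞).toReal)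
    (hm.enorm.pow_const _)
  rw [key]
  refine (lintegral_mono (g := fun _ => ENNReal.ofReal B) fun s => ?_).trans_lt (by simp)
  have hmem := params_mem A.nonempty A.isCompact hθ₁ (φ := φ) (f := f) (T := T) (h := h) (C := C) s i
  refine le_trans (le_of_eq ?_) (ENNReal.ofReal_le_ofReal (hB _ hmem))
  rw [ofReal_integral_eq_lintegral_ofReal (A.memLp_two_weighted hmem).integrable_sq
    (ae_of_all _ fun x => sq_nonneg _)]
  refine lintegral_congr fun x => ?_
  rw [← sq_abs, ENNReal.ofReal_pow (abs_nonneg _), ← Real.norm_eq_abs, ofReal_norm]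
  simp

lemma lintegral_pathGrad_sq_le (hX : IsRun P φ f T h Θ C θ₁ X)
    (A : Admissible φ f T h Θ) (hθ₁ : θ₁ ∈ Θ) (i : ℕ) :
    ∫⁻ ω, ‖pathGrad φ f T h Θ C θ₁ (fun j => X j ω) i‖ₑ ^ 2 ∂P ≤ GSq φ f T h Θ := by
  have := Measure.isProbabilityMeasure_map (μ := P) (hX.measurable_history i).aemeasurable
  simp only [pathGrad_eq]
  have hm := measurable_stochGrad_params A (C := C) (θ₁ := θ₁) i
  rw [hX.lintegral_eq A hθ₁ i
    (F := fun q => ‖stochGrad φ f T h (params φ f T h Θ C θ₁ q.1 i) q.2‖ₑ ^ 2)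
    (hm.enorm.pow_const _)]
  refine (lintegral_mono (g := fun _ => GSq φ f T h Θ) fun s => ?_).trans (by simp)
  exact Admissible.lintegral_stochGrad_sq_le (params_mem A.nonempty A.isCompact hθ₁ s i)

lemma memLp_pathGrad (hX : IsRun P φ f T h Θ C θ₁ X)
    (A : Admissible φ f T h Θ) (hθ₁ : θ₁ ∈ Θ) (i : ℕ) :
    MemLp (fun ω => pathGrad φ f T h Θ C θ₁ (fun j => X j ω) i) 2 P := by
  refine ⟨((measurable_pathGrad A i).comp hX.measurable_path).aestronglyMeasurable, ?_⟩
  rw [eLpNorm_lt_top_iff_lintegral_rpow_enorm_lt_top (by norm_num) (by norm_num)]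
  simpa using (hX.lintegral_pathGrad_sq_le A hθ₁ i).trans_lt A.GSq_lt_top

lemma integral_norm_pathGrad_sq_le (hX : IsRun P φ f T h Θ C θ₁ X)
    (A : Admissible φ f T h Θ) (hθ₁ : θ₁ ∈ Θ) (i : ℕ) :
    ∫ ω, ‖pathGrad φ f T h Θ C θ₁ (fun j => X j ω) i‖ ^ 2 ∂P ≤ (GSq φ f T h Θ).toReal := by
  rw [integral_eq_lintegral_of_nonneg_ae (ae_of_all _ fun x => sq_nonneg _)
    ((hX.memLp_pathGrad A hθ₁ i).1.norm.pow 2)]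
  refine ENNReal.toReal_mono A.GSq_lt_top.ne
    (le_trans (le_of_eq ?_) (hX.lintegral_pathGrad_sq_le A hθ₁ i))
  refine lintegral_congr fun x => ?_
  rw [ENNReal.ofReal_pow (norm_nonneg _), ofReal_norm]

/-- Conditionally on the past, the importance sampled value has mean `I`. -/
lemma integral_mul_pathWeighted (hX : IsRun P φ f T h Θ C θ₁ X)
    (A : Admissible φ f T h Θ) (hθ₁ : θ₁ ∈ Θ) (i : ℕ) {U : (ℕ → Vec k) → ℝ} (hU : Measurable U)
    (hU2 : MemLp (fun ω => U (history X i ω)) 2 P) :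
    ∫ ω, U (history X i ω) * pathWeighted φ f T h Θ C θ₁ (fun j => X j ω) i ∂P =
      (∫ ω, U (history X i ω) ∂P) * target φ f := by
  have hi := hU2.integrable_mul (hX.memLp_pathWeighted A hθ₁ i)
  have hm := measurable_weighted_params A (C := C) (θ₁ := θ₁) i
  simp only [Pi.mul_def, pathWeighted_eq] at hi ⊢
  rw [(hX.integral_eq A hθ₁ i
    (F := fun q => U q.1 * weighted φ f T h (params φ f T h Θ C θ₁ q.1 i) q.2)
    ((hU.comp measurable_fst).mul hm) hi).2, ← integral_mul_const,
    ← integral_map (f := fun s => U s * target φ f) (hX.measurable_history i).aemeasurable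
      (by fun_prop)]
  refine integral_congr_ae (ae_of_all _ fun s => ?_)
  simp only
  rw [integral_const_mul, A.integral_weighted (params_mem A.nonempty A.isCompact hθ₁ s i)]

lemma integral_pathWeighted (hX : IsRun P φ f T h Θ C θ₁ X)
    (A : Admissible φ f T h Θ) (hθ₁ : θ₁ ∈ Θ) (i : ℕ) :
    ∫ ω, pathWeighted φ f T h Θ C θ₁ (fun j => X j ω) i ∂P = target φ f := by
  simpa using hX.integral_mul_pathWeighted A hθ₁ i (U := fun _ => 1) measurable_const
    (memLp_const 1)

/-- The increments of the estimator are orthogonal. -/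
lemma integral_sum_sub_target_sq (hX : IsRun P φ f T h Θ C θ₁ X)
    (A : Admissible φ f T h Θ) (hθ₁ : θ₁ ∈ Θ) (n : ℕ) :
    ∫ ω, (∑ i ∈ Finset.range n,
        (pathWeighted φ f T h Θ C θ₁ (fun j => X j ω) i - target φ f)) ^ 2 ∂P =
      ∑ i ∈ Finset.range n,
        (∫ ω, pathWeighted φ f T h Θ C θ₁ (fun j => X j ω) i ^ 2 ∂P - target φ f ^ 2) := by
  set I := target φ f with hI
  have hw := hX.memLp_pathWeighted A hθ₁
  have hY : ∀ i, MemLp (fun ω => pathWeighted φ f T h Θ C θ₁ (fun j => X j ω) i - I) 2 P :=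
    fun i => (hw i).sub (memLp_const I)
  induction n with
  | zero => simp
  | succ n ih =>
    set U : (ℕ → Vec k) → ℝ := fun x =>
      ∑ i ∈ Finset.range n, (pathWeighted φ f T h Θ C θ₁ x i - I) with hUdef
    have hUm : Measurable U :=
      Finset.measurable_sum _ fun i _ => (measurable_pathWeighted A i).sub_const I
    have hUh : ∀ ω, U (history X n ω) = U fun j => X j ω := fun ω =>
      Finset.sum_congr rfl fun i hi => by rw [pathWeighted_history (Finset.mem_range.1 hi)]
    have hU2 : MemLp (fun ω => U fun j => X j ω) 2 P := memLp_finsetSum _ fun i _ => hY i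
    -- The partial sum `U` is a function of the past, so the cross term `2 E[U (w_n - I)]` vanishes.
    -- What remains is expanding the square and splitting the integrals.
    have hcross := hX.integral_mul_pathWeighted A hθ₁ n hUm (by simpa only [hUh] using hU2)
    simp only [hUh] at hcross
    have hUw := hU2.integrable_mul (hw n)
    simp only [Pi.mul_def] at hUw
    have hUI := (hU2.integrable one_le_two).mul_const I
    have hwn := (hw n).integrable one_le_two
    have h1 : Integrable (fun ω => 2 * ((U fun j => X j ω) *
        pathWeighted φ f T h Θ C θ₁ (fun j => X j ω) n - (U fun j => X j ω) * I)) P :=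
      (hUw.sub hUI).const_mul 2
    have h2 : Integrable (fun ω => pathWeighted φ f T h Θ C θ₁ (fun j => X j ω) n ^ 2 -
        2 * I * pathWeighted φ f T h Θ C θ₁ (fun j => X j ω) n) P :=
      (hw n).integrable_sq.sub (hwn.const_mul _)
    have h3 : Integrable (fun ω => (U fun j => X j ω) ^ 2 + 2 * ((U fun j => X j ω) *
        pathWeighted φ f T h Θ C θ₁ (fun j => X j ω) n - (U fun j => X j ω) * I)) P :=
      hU2.integrable_sq.add h1
    have h4 : Integrable (fun ω => pathWeighted φ f T h Θ C θ₁ (fun j => X j ω) n ^ 2 -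
        2 * I * pathWeighted φ f T h Θ C θ₁ (fun j => X j ω) n + I ^ 2) P :=
      h2.add (integrable_const _)
    rw [Finset.sum_range_succ, ← ih]
    have hexp : ∀ ω, (∑ i ∈ Finset.range (n + 1),
        (pathWeighted φ f T h Θ C θ₁ (fun j => X j ω) i - I)) ^ 2 =
        (U fun j => X j ω) ^ 2 +
          2 * ((U fun j => X j ω) * pathWeighted φ f T h Θ C θ₁ (fun j => X j ω) n -
            (U fun j => X j ω) * I) +
          (pathWeighted φ f T h Θ C θ₁ (fun j => X j ω) n ^ 2 -
            2 * I * pathWeighted φ f T h Θ C θ₁ (fun j => X j ω) n + I ^ 2) := fun ω => by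
      rw [Finset.sum_range_succ]
      show ((U fun j => X j ω) + _) ^ 2 = _
      ring
    simp only [hexp]
    rw [integral_add h3 h4, integral_add hU2.integrable_sq h1, integral_const_mul,
      integral_sub hUw hUI, hcross, integral_mul_const, integral_add h2 (integrable_const _),
      integral_sub (hw n).integrable_sq (hwn.const_mul _), integral_const_mul,
      hX.integral_pathWeighted A hθ₁, integral_const]
    have hUsq : ∫ ω, (U fun j => X j ω) ^ 2 ∂P = ∫ ω, (∑ i ∈ Finset.range n,
        (pathWeighted φ f T h Θ C θ₁ (fun j => X j ω) i - I)) ^ 2 ∂P := rfl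
    rw [← hUsq, probReal_univ, one_smul, ← hI]
    ring

lemma le_integral_pathWeighted_sq (hX : IsRun P φ f T h Θ C θ₁ X)
    (A : Admissible φ f T h Θ) (hθ₁ : θ₁ ∈ Θ) {v : ℝ}
    (hv : ∀ θ ∈ Θ, v ≤ ∫ x, weighted φ f T h θ x ^ 2 ∂(sampling T h θ)) (i : ℕ) :
    v ≤ ∫ ω, pathWeighted φ f T h Θ C θ₁ (fun j => X j ω) i ^ 2 ∂P := by
  have := Measure.isProbabilityMeasure_map (μ := P) (hX.measurable_history i).aemeasurable
  have hi := (hX.memLp_pathWeighted A hθ₁ i).integrable_sq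
  have hm := measurable_weighted_params A (C := C) (θ₁ := θ₁) i
  simp only [pathWeighted_eq] at hi ⊢
  obtain ⟨h1, h2⟩ := hX.integral_eq A hθ₁ i
    (F := fun q => weighted φ f T h (params φ f T h Θ C θ₁ q.1 i) q.2 ^ 2) (hm.pow_const 2) hi
  rw [h2]
  calc v = ∫ _, v ∂(P.map (history X i)) := by simp
    _ ≤ _ := integral_mono (integrable_const _) h1 fun s =>
      hv _ (params_mem A.nonempty A.isCompact hθ₁ s i)

/-- With the past frozen, this is the subgradient inequality at the current parameter, then averaged
over the past. Integrability of the inner product follows from `‖θ_i - θ'‖ ≤ D`. -/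
lemma integral_pathWeighted_sq_sub_inner_le (hX : IsRun P φ f T h Θ C θ₁ X)
    (A : Admissible φ f T h Θ) (hθ₁ : θ₁ ∈ Θ) (hθ' : θ' ∈ Θ) (i : ℕ) :
    Integrable (fun ω => ⟪pathGrad φ f T h Θ C θ₁ (fun j => X j ω) i,
        params φ f T h Θ C θ₁ (fun j => X j ω) i - θ'⟫_ℝ) P ∧
      ∫ ω, pathWeighted φ f T h Θ C θ₁ (fun j => X j ω) i ^ 2 ∂P -
        ∫ ω, ⟪pathGrad φ f T h Θ C θ₁ (fun j => X j ω) i,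
          params φ f T h Θ C θ₁ (fun j => X j ω) i - θ'⟫_ℝ ∂P ≤
      ∫ x, weighted φ f T h θ' x ^ 2 ∂(sampling T h θ') := by
  have := Measure.isProbabilityMeasure_map (μ := P) (hX.measurable_history i).aemeasurable
  have hw := (hX.memLp_pathWeighted A hθ₁ i).integrable_sq
  have hp := measurable_params A (C := C) (θ₁ := θ₁) i
  have hg : Integrable (fun ω => ⟪pathGrad φ f T h Θ C θ₁ (fun j => X j ω) i,
        params φ f T h Θ C θ₁ (fun j => X j ω) i - θ'⟫_ℝ) P := by
    refine (((hX.memLp_pathGrad A hθ₁ i).integrable one_le_two).norm.mul_const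
      (Metric.diam Θ)).mono' (((measurable_pathGrad A i).inner (hp.sub_const θ')).comp
        hX.measurable_path).aestronglyMeasurable (ae_of_all _ fun ω => ?_)
    refine (norm_inner_le_norm _ _).trans (mul_le_mul_of_nonneg_left ?_ (norm_nonneg _))
    rw [← dist_eq_norm]
    exact Metric.dist_le_diam_of_mem A.isCompact.isBounded
      (params_mem A.nonempty A.isCompact hθ₁ _ i) hθ'
  refine ⟨hg, ?_⟩
  rw [← integral_sub hw hg]
  have hd := hw.sub hg
  have hmp : Measurable fun q : (ℕ → Vec k) × Vec k => params φ f T h Θ C θ₁ q.1 i :=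
    hp.comp measurable_fst
  have hm1 := measurable_weighted_params A (C := C) (θ₁ := θ₁) i
  have hm2 := measurable_stochGrad_params A (C := C) (θ₁ := θ₁) i
  simp only [Pi.sub_def, pathWeighted_eq, pathGrad_eq, ← params_history (X := X) i _ le_rfl] at hd ⊢
  obtain ⟨h1, h2⟩ := hX.integral_eq A hθ₁ i
    (F := fun q => weighted φ f T h (params φ f T h Θ C θ₁ q.1 i) q.2 ^ 2 -
      ⟪stochGrad φ f T h (params φ f T h Θ C θ₁ q.1 i) q.2, params φ f T h Θ C θ₁ q.1 i - θ'⟫_ℝ)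
    ((hm1.pow_const 2).sub (hm2.inner (hmp.sub_const θ'))) hd
  rw [h2]
  calc _ ≤ ∫ _, (∫ x, weighted φ f T h θ' x ^ 2 ∂(sampling T h θ')) ∂(P.map (history X i)) :=
        integral_mono h1 (integrable_const _) fun s =>
          A.integral_weighted_sq_sub_inner_le (params_mem A.nonempty A.isCompact hθ₁ s i) hθ'
    _ = _ := by simp

/-- Expectation of the pathwise regret bound, using `E‖g_i‖² ≤ G²` and `∑ 1/(2√(i+1)) ≤ √n`,
combined with the subgradient inequality for each `i`. -/
lemma sum_integral_pathWeighted_sq_le (hX : IsRun P φ f T h Θ C θ₁ X)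
    (A : Admissible φ f T h Θ) (hC : 0 < C) (hθ₁ : θ₁ ∈ Θ) (hθ' : θ' ∈ Θ) (n : ℕ) :
    ∑ i ∈ Finset.range n, ∫ ω, pathWeighted φ f T h Θ C θ₁ (fun j => X j ω) i ^ 2 ∂P ≤
      n * ∫ x, weighted φ f T h θ' x ^ 2 ∂(sampling T h θ') +
        (Metric.diam Θ ^ 2 / (2 * C) + C * (GSq φ f T h Θ).toReal) * √n := by
  set G := (GSq φ f T h Θ).toReal
  have hi : ∀ i ∈ Finset.range n, Integrable (fun ω => C / (2 * √((i : ℝ) + 1)) *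
      ‖pathGrad φ f T h Θ C θ₁ (fun j => X j ω) i‖ ^ 2) P := fun i _ =>
    ((hX.memLp_pathGrad A hθ₁ i).integrable_norm_pow').const_mul _
  have hinner := fun i (_ : i ∈ Finset.range n) =>
    (hX.integral_pathWeighted_sq_sub_inner_le A hθ₁ hθ' i).1
  have hrhs : Integrable (fun ω => Metric.diam Θ ^ 2 * √n / (2 * C) + ∑ i ∈ Finset.range n,
      C / (2 * √((i : ℝ) + 1)) * ‖pathGrad φ f T h Θ C θ₁ (fun j => X j ω) i‖ ^ 2) P :=
    (integrable_const _).add (integrable_finsetSum _ hi)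
  have hreg := integral_mono (integrable_finsetSum _ hinner) hrhs
    fun ω => sum_inner_stochGrad_le A hC hθ₁ hθ' (fun j => X j ω) n
  rw [integral_finsetSum _ hinner, integral_add (integrable_const _) (integrable_finsetSum _ hi),
    integral_finsetSum _ hi] at hreg
  simp only [integral_const_mul, integral_const, probReal_univ, one_smul] at hreg
  have hG : ∑ i ∈ Finset.range n, C / (2 * √((i : ℝ) + 1)) *
      ∫ ω, ‖pathGrad φ f T h Θ C θ₁ (fun j => X j ω) i‖ ^ 2 ∂P ≤ C * G * √n := by
    calc _ ≤ ∑ i ∈ Finset.range n, C * G * (1 / (2 * √((i : ℝ) + 1))) := by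
          refine Finset.sum_le_sum fun i _ => ?_
          have := mul_le_mul_of_nonneg_left (hX.integral_norm_pathGrad_sq_le A hθ₁ i)
            (show 0 ≤ C / (2 * √((i : ℝ) + 1)) by positivity)
          refine this.trans (le_of_eq ?_)
          ring
      _ ≤ _ := by
          rw [← Finset.mul_sum]
          exact mul_le_mul_of_nonneg_left (sum_inv_sqrt_le n) (by positivity)
  have hconv := Finset.sum_le_sum fun i (_ : i ∈ Finset.range n) =>
    (hX.integral_pathWeighted_sq_sub_inner_le A hθ₁ hθ' i).2
  rw [Finset.sum_sub_distrib, Finset.sum_const, Finset.card_range, nsmul_eq_mul] at hconv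
  have e : (Metric.diam Θ ^ 2 / (2 * C) + C * G) * √n =
      Metric.diam Θ ^ 2 * √n / (2 * C) + C * G * √n := by ring
  rw [e]
  have hreg' := hreg.trans (add_le_add_right hG _)
  exact (sub_le_iff_le_add.1 hconv).trans (add_le_add_right hreg' _)

end IsRun

end ConvexAdaMC

/-! ### From expected regret to the variance of the estimator -/

namespace ConvexAdaMC

variable {k p : ℕ} {φ f : Vec k → ℝ} {T : Vec k → Vec p} {h : Vec k → ℝ} {Θ : Set (Vec p)}
  {C : ℝ} {θ₁ θ : Vec p} {Ω : Type*} {X : ℕ → Ω → Vec k} [MeasurableSpace Ω] {P : Measure Ω}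

namespace Admissible

lemma optimalV_nonneg (A : Admissible φ f T h Θ) : 0 ≤ optimalV φ f T h Θ :=
  le_iInf₂ fun θ hθ => by
    rw [A.V_eq hθ, ← EReal.coe_zero, EReal.coe_le_coe_iff]
    linarith [A.target_sq_le hθ]

lemma optimalV_lt_top (A : Admissible φ f T h Θ) : optimalV φ f T h Θ < ⊤ := by
  obtain ⟨θ, hθ⟩ := A.nonempty
  refine (iInf₂_le θ hθ).trans_lt ?_
  rw [A.V_eq hθ]
  exact EReal.coe_lt_top _

lemma coe_toReal_optimalV (A : Admissible φ f T h Θ) :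
    ((optimalV φ f T h Θ).toReal : EReal) = optimalV φ f T h Θ :=
  EReal.coe_toReal A.optimalV_lt_top.ne (EReal.bot_lt_zero.trans_le A.optimalV_nonneg).ne'

lemma toReal_optimalV_le (A : Admissible φ f T h Θ) (hθ : θ ∈ Θ) :
    (optimalV φ f T h Θ).toReal ≤
      ∫ x, weighted φ f T h θ x ^ 2 ∂(sampling T h θ) - target φ f ^ 2 := by
  rw [← EReal.coe_le_coe_iff, A.coe_toReal_optimalV, ← A.V_eq hθ]
  exact iInf₂_le θ hθ

lemma le_toReal_optimalV (A : Admissible φ f T h Θ) {c : ℝ}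
    (hc : ∀ θ ∈ Θ, c ≤ ∫ x, weighted φ f T h θ x ^ 2 ∂(sampling T h θ) - target φ f ^ 2) :
    c ≤ (optimalV φ f T h Θ).toReal := by
  rw [← EReal.coe_le_coe_iff, A.coe_toReal_optimalV]
  exact le_iInf₂ fun θ hθ => by
    rw [A.V_eq hθ, EReal.coe_le_coe_iff]
    exact hc θ hθ

end Admissible

namespace IsRun

variable [IsProbabilityMeasure P]

lemma memLp_estimator (hX : IsRun P φ f T h Θ C θ₁ X) (A : Admissible φ f T h Θ) (hθ₁ : θ₁ ∈ Θ)
    (n : ℕ) : MemLp (estimator φ f T h Θ C θ₁ X n) 2 P :=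
  (memLp_finsetSum (Finset.range n) fun i _ => hX.memLp_pathWeighted A hθ₁ i).const_mul _

lemma integral_estimator (hX : IsRun P φ f T h Θ C θ₁ X) (A : Admissible φ f T h Θ) (hθ₁ : θ₁ ∈ Θ)
    {n : ℕ} (hn : 1 ≤ n) : ∫ ω, estimator φ f T h Θ C θ₁ X n ω ∂P = target φ f := by
  have hn0 : (n : ℝ) ≠ 0 := by positivity
  have key : ∫ ω, 1 / (n : ℝ) * ∑ i ∈ Finset.range n,
      pathWeighted φ f T h Θ C θ₁ (fun j => X j ω) i ∂P = target φ f := by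
    rw [integral_const_mul, integral_finsetSum _ fun i _ =>
      (hX.memLp_pathWeighted A hθ₁ i).integrable one_le_two]
    simp only [hX.integral_pathWeighted A hθ₁, Finset.sum_const, Finset.card_range, nsmul_eq_mul]
    field_simp
  exact key

lemma variance_estimator (hX : IsRun P φ f T h Θ C θ₁ X) (A : Admissible φ f T h Θ) (hθ₁ : θ₁ ∈ Θ)
    {n : ℕ} (hn : 1 ≤ n) :
    variance (estimator φ f T h Θ C θ₁ X n) P = (∑ i ∈ Finset.range n,
      (∫ ω, pathWeighted φ f T h Θ C θ₁ (fun j => X j ω) i ^ 2 ∂P - target φ f ^ 2)) /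
        (n : ℝ) ^ 2 := by
  have hn0 : (n : ℝ) ≠ 0 := by positivity
  rw [variance_eq_integral (hX.memLp_estimator A hθ₁ n).1.aemeasurable,
    hX.integral_estimator A hθ₁ hn, ← hX.integral_sum_sub_target_sq A hθ₁, ← integral_div]
  refine integral_congr_ae (ae_of_all _ fun ω => ?_)
  have hest : estimator φ f T h Θ C θ₁ X n ω = 1 / (n : ℝ) * ∑ i ∈ Finset.range n,
      pathWeighted φ f T h Θ C θ₁ (fun j => X j ω) i := rfl
  simp only [hest, Finset.sum_sub_distrib, Finset.sum_const, Finset.card_range, nsmul_eq_mul]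
  field_simp

lemma le_variance_estimator (hX : IsRun P φ f T h Θ C θ₁ X) (A : Admissible φ f T h Θ)
    (hθ₁ : θ₁ ∈ Θ) {n : ℕ} (hn : 1 ≤ n) :
    (optimalV φ f T h Θ).toReal / n ≤ variance (estimator φ f T h Θ C θ₁ X n) P := by
  have hn0 : (0 : ℝ) < n := by positivity
  rw [hX.variance_estimator A hθ₁ hn, le_div_iff₀ (by positivity)]
  have hle := Finset.card_nsmul_le_sum (Finset.range n) _ _ fun i _ => le_sub_iff_add_le.2
    (hX.le_integral_pathWeighted_sq A hθ₁
      (fun θ hθ => le_sub_iff_add_le.1 (A.toReal_optimalV_le hθ)) i)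
  rw [Finset.card_range, nsmul_eq_mul] at hle
  refine le_trans (le_of_eq ?_) hle
  field_simp

lemma variance_estimator_le (hX : IsRun P φ f T h Θ C θ₁ X) (A : Admissible φ f T h Θ)
    (hC : 0 < C) (hθ₁ : θ₁ ∈ Θ) {n : ℕ} (hn : 1 ≤ n) :
    variance (estimator φ f T h Θ C θ₁ X n) P ≤ (optimalV φ f T h Θ).toReal / n +
      (Metric.diam Θ ^ 2 / (2 * C) + C * (GSq φ f T h Θ).toReal) / (n : ℝ) ^ (3 / 2 : ℝ) := by
  have hn0 : (0 : ℝ) < n := by positivity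
  set b := Metric.diam Θ ^ 2 / (2 * C) + C * (GSq φ f T h Θ).toReal
  rw [hX.variance_estimator A hθ₁ hn, Finset.sum_sub_distrib, Finset.sum_const, Finset.card_range,
    nsmul_eq_mul]
  set s := ∑ i ∈ Finset.range n, ∫ ω, pathWeighted φ f T h Θ C θ₁ (fun j => X j ω) i ^ 2 ∂P
  -- The regret bound holds against every comparator in `Θ`, so its rearrangement is a lower bound
  -- for all `V(θ)` and hence for the infimum; no minimizer is needed.
  have hs : (s - n * target φ f ^ 2 - b * √n) / n ≤ (optimalV φ f T h Θ).toReal := by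
    refine A.le_toReal_optimalV fun θ hθ => ?_
    rw [div_le_iff₀ hn0]
    linarith [hX.sum_integral_pathWeighted_sq_le A hC hθ₁ hθ n]
  have hpow : (n : ℝ) ^ (3 / 2 : ℝ) * √n = (n : ℝ) ^ 2 := by
    rw [Real.sqrt_eq_rpow, ← Real.rpow_add hn0]
    norm_num
  have hb : b / (n : ℝ) ^ (3 / 2 : ℝ) = b * √n / (n : ℝ) ^ 2 := by
    have : 0 < √(n : ℝ) := Real.sqrt_pos.2 hn0
    rw [← hpow, mul_div_mul_right _ _ this.ne']
  have hdiv := div_le_div_of_nonneg_right hs hn0.le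
  rw [div_div, ← sq] at hdiv
  rw [hb]
  rw [sub_div] at hdiv
  linarith

end IsRun

end ConvexAdaMC

theorem mainTheorem2 {k p : ℕ}
    (φ f : ConvexAdaMC.Vec k → ℝ) (T : ConvexAdaMC.Vec k → ConvexAdaMC.Vec p)
    (h : ConvexAdaMC.Vec k → ℝ)
    (hφ : Measurable φ)
    (hf : Measurable f) (hf_nonneg : ∀ x, 0 ≤ f x) (hf_one : ∫⁻ x, ENNReal.ofReal (f x) = 1)
    (hT : Measurable T)
    (hh : Measurable h) (hh_nonneg : ∀ x, 0 ≤ h x) (hh_ne : ¬ ∀ᵐ x, h x = 0)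
    (Θ : Set (ConvexAdaMC.Vec p))
    (hΘ_sub : Θ ⊆ interior {θ | ConvexAdaMC.K φ f T h θ < ⊤})
    (hΘ_ne : Θ.Nonempty) (hΘ_conv : Convex ℝ Θ) (hΘ_comp : IsCompact Θ) :
    -- `I`, `∇A` on `Θ` and `V⋆` are well defined and finite
    Integrable (fun x => φ x * f x) ∧
    (∀ θ ∈ Θ, DifferentiableAt ℝ (fun t => (ConvexAdaMC.logPartition T h t).toReal) θ) ∧
    ⊥ < ConvexAdaMC.optimalV φ f T h Θ ∧ ConvexAdaMC.optimalV φ f T h Θ < ⊤ ∧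
    ConvexAdaMC.GSq φ f T h Θ < ⊤ ∧
    ∀ (Ω : Type*) [MeasurableSpace Ω] (P : Measure Ω) [IsProbabilityMeasure P]
      (C : ℝ) (_ : 0 < C) (θ₁ : ConvexAdaMC.Vec p) (_ : θ₁ ∈ Θ)
      (X : ℕ → Ω → ConvexAdaMC.Vec k) (_ : ConvexAdaMC.IsRun P φ f T h Θ C θ₁ X)
      (n : ℕ) (_ : 1 ≤ n),
      MemLp (ConvexAdaMC.estimator φ f T h Θ C θ₁ X n) 2 P ∧
      ∫ ω, ConvexAdaMC.estimator φ f T h Θ C θ₁ X n ω ∂P = ConvexAdaMC.target φ f ∧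
      (ConvexAdaMC.optimalV φ f T h Θ).toReal / n
        ≤ variance (ConvexAdaMC.estimator φ f T h Θ C θ₁ X n) P ∧
      variance (ConvexAdaMC.estimator φ f T h Θ C θ₁ X n) P
        ≤ (ConvexAdaMC.optimalV φ f T h Θ).toReal / n
          + (Metric.diam Θ ^ 2 / (2 * C) + C * (ConvexAdaMC.GSq φ f T h Θ).toReal)
            / (n : ℝ) ^ (3 / 2 : ℝ) := by
  have h0 := ConvexAdaMC.partition_ne_zero (T := T) hT hh hh_nonneg hh_ne
  have A : ConvexAdaMC.Admissible φ f T h Θ :=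
    ⟨hφ, hf, hT, hh, hh_nonneg, h0, hΘ_sub, hΘ_ne, hΘ_conv, hΘ_comp⟩
  obtain ⟨θ₀, hθ₀⟩ := hΘ_ne
  refine ⟨ConvexAdaMC.integrable_mul_of_K_lt_top hφ hf hT hh hh_nonneg (h0 θ₀) (A.K_lt_top hθ₀),
    fun θ hθ => ?_, EReal.bot_lt_zero.trans_le A.optimalV_nonneg, A.optimalV_lt_top,
    A.GSq_lt_top, ?_⟩
  · exact (ConvexAdaMC.hasGradientAt_logPartition hT hh (h0 θ) ((A.eventually_K_lt_top hθ).mono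
      fun t ht => ConvexAdaMC.partition_ne_top_of_K_lt_top ht)).differentiableAt
  · intro Ω _ P _ C hC θ₁ hθ₁ X hX n hn
    exact ⟨hX.memLp_estimator A hθ₁ n, hX.integral_estimator A hθ₁ hn,
      hX.le_variance_estimator A hθ₁ hn, hX.variance_estimator_le A hC hθ₁ hn⟩
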